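/- A \emph{noncommutative probability space} $(\mathcal A,\varphi)$ is a unital complex $*$-algebra $\mathcal A$ with a state $\varphi$, i.e. a linear functional with $\varphi(1)=1$ and $\varphi(X^*X)\ge 0$ for all $X$; $\varphi$ is \emph{faithful} if $\varphi(X^*X)=0$ implies $X=0$. An \emph{exchangeability system} $\mathcal E=(\mathcal U,\tilde\varphi,(\iota_k)_{k\in\mathbb N})$ for $(\mathcal A,\varphi)$ consists of a noncommutative probability space $(\mathcal U,\tilde\varphi)$ and injective unital $*$-homomorphisms $\iota_k:\mathcal A\to\mathcal U$, $X\mapsto X^{(k)}$, with $\tilde\varphi\circ\iota_k=\varphi$ and $$\tilde\varphi\bigl(X_1^{(h(1))}\cdots X_n^{(h(n))}\bigr)=\tilde\varphi\bigl(X_1^{(\sigma(h(1)))}\cdots X_n^{(\sigma(h(n)))}\bigr)$$ for all $X_j\in\mathcal A$, $h:\{1,\dots,n\}\to\mathbb N$ and all permutations $\sigma$ of $\mathbb N$. Put $\mathcal A_k=\iota_k(\mathcal A)$ and, for $I\subseteq\mathbb N$, let $\mathcal A_I$ be the algebra generated by the $\mathcal A_i$, $i\in I$. For a set partition $\pi$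 of $\{1,\dots,n\}$ let $\varphi_\pi(X_1,\dots,X_n)=\tilde\varphi(X_1^{(h(1))}\cdots X_n^{(h(n))})$, where $h$ is any function with $h(i)=h(j)\iff i\sim_\pi j$, and define the cumulants $$K_\pi(X_1,\dots,X_n)=\sum_{\sigma\le\pi}\varphi_\sigma(X_1,\dots,X_n)\,\mu(\sigma,\pi),$$ where $\mu$ is the Möbius function of the lattice of set partitions ordered by refinement. \emph{Crossing cumulants vanish} if $K_\pi(X_1,\dots,X_n)=0$ for all $n$, all $X_j\in\mathcal A$ and all $\pi$ that have a crossing, i.e. there are $i<j<k<l$ with $i\sim_\pi k$, $j\sim_\pi l$, $i\not\sim_\pi j$. $\mathcal E$ satisfies the \emph{weak singleton condition} if $\tilde\varphi(X_1^{(i_1)}\cdots X_n^{(i_n)})=0$ whenever some index $i_j$ occurs only once among $i_1,\dots,i_n$ and $\tilde\varphi\bigl((X_j^{(1)})^*X_j^{(2)}\bigr)=0$. It satisfies \emph{weak freeness} if $\tilde\varphi(X_1\cdots X_n)=0$ for every $n\ge 1$ whenever $(I_k)_k$ are disjoint subsets of $\mathbb N$, $X_j\in\mathcal A_{I_{i_j}}$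 with $i_j\ne i_{j+1}$ for $1\le j\le n-1$, and $\tilde\varphi\bigl((X_j^{(1)})^*X_j^{(2)}\bigr)=0$ for all $j$, where $X_j^{(1)}$ and $X_j^{(2)}$ are the copies of $X_j$ in $\mathcal A_{I'}$ and $\mathcal A_{I''}$ for two disjoint copies $I',I''\subseteq\mathbb N$ of $I_{i_j}$ (that is, a polynomial in elements of the $\mathcal A_i$, $i\in I_{i_j}$, that represents $X_j$ is evaluated with its indices relabelled). \textbf{Theorem.} Let $\mathcal E=(\mathcal U,\tilde\varphi,(\iota_k))$ be an exchangeability system for $(\mathcal A,\varphi)$ with faithful state $\tilde\varphi$ that satisfies both weak freeness and the weak singleton condition. Then crossing cumulants vanish. In particular, $\mathcal E$ can be embedded into an amalgamated free product, in the following sense. There are a unital $*$-algebra $\mathcal U'$, a unital $*$-subalgebra $\mathcal B\subseteq\mathcal U'$, a conditional expectation $E:\mathcal U'\to\mathcal B$ (a linear $\mathcal B$-bimodule map that is the identity on $\mathcal B$ and is positive, i.e. $\tau(Y^*E(X^*X)Y)\ge0$ for all $X,Y\in\mathcal U'$), a state $\tau=\tau\circ E$ on $\mathcal U'$ whose GNS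 representation is faithful (if $\tau(YXZ)=0$ for all $Y,Z$, then $X=0$), and a unital $*$-algebra $\mathcal A'\supseteq\mathcal B$ with injective unital $*$-homomorphisms $\kappa_k:\mathcal A'\to\mathcal U'$, $k\in\mathbb N$, such that every $\kappa_k$ is the identity on $\mathcal B$, $E\circ\kappa_k$ does not depend on $k$, the algebras $\kappa_k(\mathcal A')$ generate $\mathcal U'$, and they are free with amalgamation over $\mathcal B$: $$E\bigl(\kappa_{i_1}(Y_1)\cdots\kappa_{i_n}(Y_n)\bigr)=0\quad\text{whenever } n\ge1,\ E(\kappa_{i_j}(Y_j))=0 \text{ for all } j \text{ and } i_j\ne i_{j+1};$$ and there are an injective unital $*$-homomorphism $f$ from the $*$-subalgebra of $\mathcal U$ generated by the $\mathcal A_k$ into $\mathcal U'$ with $\tau\circ f=\tilde\varphi$, and a unital $*$-homomorphism $\theta:\mathcal A\to\mathcal A'$, with $f(X^{(k)})=\kappa_k(\theta(X))$ for all $X\in\mathcal A$ and $k\in\mathbb N$. -/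

import Mathlib

open scoped ComplexOrder

noncomputable section

/-- A state on a unital complex star-algebra: a unital positive linear functional. -/
structure IsState {A : Type*} [Ring A] [StarRing A] [Algebra ℂ A] (φ : A →ₗ[ℂ] ℂ) : Prop where
  map_one : φ 1 = 1
  nonneg : ∀ x : A, 0 ≤ φ (star x * x)

/-- A functional is faithful if it does not vanish on `x* x` for `x ≠ 0`. -/
def IsFaithful {A : Type*} [Ring A] [StarRing A] [Algebra ℂ A] (φ : A →ₗ[ℂ] ℂ) : Prop :=
  ∀ x : A, φ (star x * x) = 0 → x = 0

/-- An exchangeability system `(U, Φ, (ι k))` for the noncommutative probability space `(A, φ)`: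
state-preserving embeddings `ι k : A → U`, written `X ↦ X^(k)`, such that expectations of words
are invariant under permutations of the indices. -/
structure ExchangeabilitySystem {A U : Type*}
    [Ring A] [StarRing A] [Algebra ℂ A] [StarModule ℂ A]
    [Ring U] [StarRing U] [Algebra ℂ U] [StarModule ℂ U]
    (φ : A →ₗ[ℂ] ℂ) (Φ : U →ₗ[ℂ] ℂ) where
  isState_base : IsState φ
  isState : IsState Φ
  ι : ℕ → A →⋆ₐ[ℂ] U
  ι_injective : ∀ k, Function.Injective (ι k)
  map_ι : ∀ k a, Φ (ι k a) = φ a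
  exchangeable : ∀ (n : ℕ) (X : Fin n → A) (h : Fin n → ℕ) (σ : Equiv.Perm ℕ),
    Φ (List.ofFn fun j => ι (σ (h j)) (X j)).prod = Φ (List.ofFn fun j => ι (h j) (X j)).prod

/-! ### Set partitions -/

/-- Set partitions of `{1, …, n}` are equivalence relations on `Fin n`; `σ ≤ π` means that `σ` is
finer than `π`. -/
abbrev SetPartition (n : ℕ) : Type := Setoid (Fin n)

namespace SetPartition

instance instFinite (n : ℕ) : Finite (SetPartition n) :=
  Finite.of_injective (fun (r : Setoid (Fin n)) => fun a b => r a b)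
    (fun _ _ h => Setoid.ext fun a b => by simpa using congrFun (congrFun h a) b)

instance instFintype (n : ℕ) : Fintype (SetPartition n) := Fintype.ofFinite _

instance instDecidableEq (n : ℕ) : DecidableEq (SetPartition n) := Classical.decEq _

open Classical in
instance instLocallyFiniteOrder (n : ℕ) : LocallyFiniteOrder (SetPartition n) :=
  Fintype.toLocallyFiniteOrder

/-- A numbering of the blocks of `π`: an element is sent to (the value of) a chosen representative
of its block. -/
def blockNumber {n : ℕ} (π : SetPartition n) (i : Fin n) : ℕ :=
  ((Quotient.mk π i).out : Fin n).val

theorem blockNumber_eq_iff {n : ℕ} (π : SetPartition n) (i j : Fin n) :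
    π.blockNumber i = π.blockNumber j ↔ π i j := by
  unfold blockNumber
  rw [Fin.val_inj, Quotient.out_inj, Quotient.eq]

/-- There are no `i < j < k < l` with `i ∼ k`, `j ∼ l` and `i ≁ j`. -/
def IsNoncrossing {n : ℕ} (π : SetPartition n) : Prop :=
  ∀ i j k l : Fin n, i < j → j < k → k < l → π i k → π j l → π i j

end SetPartition

namespace ExchangeabilitySystem

variable {A U : Type*}
  [Ring A] [StarRing A] [Algebra ℂ A] [StarModule ℂ A]
  [Ring U] [StarRing U] [Algebra ℂ U] [StarModule ℂ U]
  {φ : A →ₗ[ℂ] ℂ} {Φ : U →ₗ[ℂ] ℂ} (S : ExchangeabilitySystem φ Φ)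

/-- The word `X₁^(h(1)) X₂^(h(2)) ⋯ Xₙ^(h(n))`. -/
def word {n : ℕ} (h : Fin n → ℕ) (X : Fin n → A) : U :=
  (List.ofFn fun j => S.ι (h j) (X j)).prod

/-- The partitioned expectation `φ_π(X₁, …, Xₙ)`. -/
def partitionedExpectation {n : ℕ} (π : SetPartition n) (X : Fin n → A) : ℂ :=
  Φ (S.word π.blockNumber X)

/-- The cumulant `K_π(X₁, …, Xₙ) = ∑_{σ ≤ π} φ_σ(X₁, …, Xₙ) μ(σ, π)`, where `μ` is the Möbius
function of the lattice of set partitions. -/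
def cumulant {n : ℕ} (π : SetPartition n) (X : Fin n → A) : ℂ :=
  ∑ σ ∈ Finset.Icc ⊥ π, S.partitionedExpectation σ X * IncidenceAlgebra.mu ℂ σ π

def CrossingCumulantsVanish : Prop :=
  ∀ (n : ℕ) (π : SetPartition n) (X : Fin n → A), ¬ π.IsNoncrossing → S.cumulant π X = 0

/-- The weak singleton condition: a word has expectation zero if some index occurs only once, at an
element `X j` with `Φ((X j)^(1)* (X j)^(2)) = 0`. -/
def WeakSingleton : Prop :=
  ∀ (n : ℕ) (i : Fin n → ℕ) (X : Fin n → A) (j : Fin n),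
    (∀ k, i k = i j → k = j) → Φ (star (S.ι 1 (X j)) * S.ι 2 (X j)) = 0 → Φ (S.word i X) = 0

/-- Evaluation of a polynomial in the letters `(i, a)`, `i ∈ I`, `a ∈ A`, at `(i, a) ↦ a^(τ i)`.
For the inclusion `τ` of `I` in `ℕ` the values are exactly the elements of the subalgebra `A_I`
generated by the `A_i`, `i ∈ I`; for an injective `τ : I → ℕ` the value at `τ` is the copy, in the
subalgebra indexed by the copy `τ(I)` of `I`, of the value at the inclusion. -/
def eval {I : Set ℕ} (τ : I → ℕ) : FreeAlgebra ℂ (I × A) →ₐ[ℂ] U :=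
  FreeAlgebra.lift ℂ fun p => S.ι (τ p.1) p.2

/-- Weak freeness: `Φ(X₁ ⋯ Xₙ) = 0` (`n ≥ 1`) whenever the `I k` are disjoint sets of indices,
`X j` lies in the subalgebra indexed by `I (i j)`, neighbouring `i j` are different, and
`Φ((X j)^(1)* (X j)^(2)) = 0` for the copies `(X j)^(1)`, `(X j)^(2)` of `X j` in the subalgebras
indexed by two disjoint copies of `I (i j)`. -/
def WeakFreeness : Prop :=
  ∀ (n : ℕ) (I : ℕ → Set ℕ) (i : Fin (n + 1) → ℕ)
    (P : ∀ j : Fin (n + 1), FreeAlgebra ℂ (I (i j) × A))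
    (τ₁ τ₂ : ∀ j : Fin (n + 1), I (i j) → ℕ),
    Pairwise (fun k l => Disjoint (I k) (I l)) →
    (∀ j : Fin n, i j.castSucc ≠ i j.succ) →
    (∀ j, Function.Injective (τ₁ j)) → (∀ j, Function.Injective (τ₂ j)) →
    (∀ j, Disjoint (Set.range (τ₁ j)) (Set.range (τ₂ j))) →
    (∀ j, Φ (star (S.eval (τ₁ j) (P j)) * S.eval (τ₂ j) (P j)) = 0) →
    Φ (List.ofFn fun j => S.eval Subtype.val (P j)).prod = 0

/-- The star-subalgebra of `U` generated by all the `A_k = ι k (A)`. -/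
def generated : StarSubalgebra ℂ U :=
  StarAlgebra.adjoin ℂ (⋃ k, Set.range (S.ι k))

theorem ι_mem_generated (k : ℕ) (a : A) : S.ι k a ∈ S.generated :=
  StarAlgebra.subset_adjoin ℂ _ (Set.mem_iUnion.2 ⟨k, a, rfl⟩)

end ExchangeabilitySystem

/-! ### Amalgamated free products -/

/-- `U` is the (reduced) free product, with amalgamation over `B`, of infinitely many copies of a
`B`-valued noncommutative probability space `A`, equipped with a state of the form
`τ = τ|_B ∘ E`, where `E : U → B` is the conditional expectation of the free product. -/
structure AmalgamatedFreeProduct (A U : Type*)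
    [Ring A] [StarRing A] [Algebra ℂ A] [StarModule ℂ A]
    [Ring U] [StarRing U] [Algebra ℂ U] [StarModule ℂ U] where
  /-- the subalgebra over which one amalgamates -/
  B : StarSubalgebra ℂ U
  /-- the conditional expectation onto `B` -/
  E : U →ₗ[ℂ] U
  E_mem : ∀ x, E x ∈ B
  E_of_mem : ∀ b ∈ B, E b = b
  E_bimodule : ∀ b ∈ B, ∀ c ∈ B, ∀ x, E (b * x * c) = b * E x * c
  /-- the state -/
  τ : U →ₗ[ℂ] ℂ
  isState : IsState τ
  τ_E : ∀ x, τ (E x) = τ x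
  /-- the GNS representation of `τ` is faithful -/
  τ_nondegenerate : ∀ x, (∀ y z, τ (y * x * z) = 0) → x = 0
  /-- `E` is positive: `E (x* x)` is a positive operator on the GNS space of `τ` -/
  E_positive : ∀ x y, 0 ≤ τ (star y * E (star x * x) * y)
  /-- the copies of `A` in `U` -/
  κ : ℕ → A →⋆ₐ[ℂ] U
  κ_injective : ∀ k, Function.Injective (κ k)
  /-- `B` is a subalgebra of `A`, and the copies of `A` are amalgamated along it -/
  β : B →⋆ₐ[ℂ] A
  κ_β : ∀ k (b : B), κ k (β b) = b
  /-- all `κ k` transport the conditional expectation of `U` to the same one on `A` -/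
  E_κ : ∀ k l a, E (κ k a) = E (κ l a)
  /-- `U` is generated by the copies of `A` -/
  generates : StarAlgebra.adjoin ℂ (⋃ k, Set.range (κ k)) = ⊤
  /-- the copies of `A` are free with amalgamation over `B` -/
  free : ∀ (n : ℕ) (i : Fin (n + 1) → ℕ) (X : Fin (n + 1) → A),
    (∀ j : Fin n, i j.castSucc ≠ i j.succ) → (∀ j, E (κ (i j) (X j)) = 0) →
    E (List.ofFn fun j => κ (i j) (X j)).prod = 0

/-- The exchangeability system embeds into an amalgamated free product: there are an injective
state-preserving star-homomorphism `f` from the algebra generated by the `A_k` to an amalgamated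
free product of copies of some `A'`, and a star-homomorphism `θ : A → A'`, with
`f (a^(k)) = κ k (θ a)`. -/
def ExchangeabilitySystem.EmbedsInAmalgamatedFreeProduct.{u, v} {A : Type u} {U : Type v}
    [Ring A] [StarRing A] [Algebra ℂ A] [StarModule ℂ A]
    [Ring U] [StarRing U] [Algebra ℂ U] [StarModule ℂ U]
    {φ : A →ₗ[ℂ] ℂ} {Φ : U →ₗ[ℂ] ℂ} (S : ExchangeabilitySystem φ Φ) : Prop :=
  ∃ (A' U' : Type v)
    (_ : Ring A') (_ : StarRing A') (_ : Algebra ℂ A') (_ : StarModule ℂ A')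
    (_ : Ring U') (_ : StarRing U') (_ : Algebra ℂ U') (_ : StarModule ℂ U')
    (F : AmalgamatedFreeProduct A' U') (f : S.generated →⋆ₐ[ℂ] U') (θ : A →⋆ₐ[ℂ] A'),
    Function.Injective f ∧
    (∀ x : S.generated, F.τ (f x) = Φ x) ∧
    (∀ k a, f ⟨S.ι k a, S.ι_mem_generated k a⟩ = F.κ k (θ a))

end

/-!
The whole theorem rests on one algebraic construction, the *envelope* of an exchangeability system.

Exchangeability says that expectations of words depend only on which indices coincide. Hence, for a
polynomial `x` in the letters `a^(k)`, the average of many copies of `x` with disjoint indices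
behaves, inside an expectation, like a single copy of `x` with fresh indices: in products of such
averages the terms with coinciding indices are negligible. The limit of the averages is the
conditional expectation of `x` onto the tail algebra, but it need not exist in `U`. The envelope
contains it formally. Its elements are polynomials with *real* indices (even numbers) and *dummy*
indices (odd numbers), where a dummy index stands for an average over all its values; so before two
polynomials are multiplied, their dummy indices are renamed apart. Faithfulness of `Φ` makes
relabelling of indices well defined on the algebra generated by the `A_k`. On that algebra the
polynomials `x` with `Φ (u x v) = 0` for all `u`, `v` with real indices form a null space, and the
quotient by it is a star-algebra. The key point is that a null polynomial remains null when its real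
indices are changed, or replaced by dummies (`map_mul_relabel_mul_eq_zero`). So turning real into
dummy indices is a well-defined map `E`, a conditional expectation onto the algebra `B` of
polynomials with only dummy indices. The state induced by `Φ` is positive by averaging
(`isState_state`), and so is `E` (`condExp_positive`).

Weak freeness gives freeness over `B`. If dummy indices are replaced by fresh genuine indices, an
alternating product of centred elements of the envelope becomes a product to which weak freeness
applies, since the condition `Φ ((X^(1))* X^(2)) = 0` expresses that `E X` is a null vector
(`state_prod_ofFn_eq_zero`). To obtain `E (X₁ ⋯ Xₙ) = 0` and not only `τ (X₁ ⋯ Xₙ) = 0`, one tests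
against `u`, `v` with other real indices, each of which is split into a centred part, which
lengthens the alternating product, and a part in `B`, which is absorbed by a neighbour
(`condExp_prod_eq_zero`). The subalgebra generated by the polynomials with one real index is the
required amalgamated free product.

Crossing cumulants vanish for every exchangeability system that embeds into an amalgamated free
product. As a function of the index labelling `h`, an expectation `τ (κ_{h 1}(Y₁) ⋯ κ_{h n}(Yₙ))` is
a linear combination of indicator functions `[ρ ≤ ker h]` with `ρ` noncrossing
(`mem_noncrossingSpan`). This follows by induction on `n`: elements of `B` can be absorbed, so that
the factors may be taken centred; then freeness makes the function vanish unless two neighbouring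
labels agree, in which case the two factors can be multiplied. The Möbius sum that defines `K_π`
maps `[ρ ≤ ·]` to `1` if `ρ = π` and to `0` otherwise, hence `K_π = 0` for crossing `π`.
-/

noncomputable section

/-! ### Exchangeability in terms of relabelled pairs -/

/-- A relation between indices is a partial bijection: it relates each index to at most one index,
in both directions. -/
def IsPartialBijection (R : ℕ → ℕ → Prop) : Prop :=
  ∀ k l k' l', R k l → R k' l' → (k = k' ↔ l = l')

/-- An injection defined on a finite set extends to a permutation of `ℕ`. -/
theorem exists_perm_eqOn (F : Finset ℕ) (g : ℕ → ℕ) (hg : Set.InjOn g F) :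
    ∃ σ : Equiv.Perm ℕ, ∀ k ∈ F, σ k = g k := by
  obtain ⟨σ, hσ⟩ := Equiv.Perm.exists_extending_pair (fun k : F => k.1) (fun k : F => g k.1)
    Subtype.val_injective fun a b h => Subtype.ext (hg a.2 b.2 h)
  exact ⟨σ, fun k hk => hσ ⟨k, hk⟩⟩

namespace ExchangeabilitySystem

variable {A U : Type*}
  [Ring A] [StarRing A] [Algebra ℂ A] [StarModule ℂ A]
  [Ring U] [StarRing U] [Algebra ℂ U] [StarModule ℂ U]
  {φ : A →ₗ[ℂ] ℂ} {Φ : U →ₗ[ℂ] ℂ} (S : ExchangeabilitySystem φ Φ)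

/-- Expectations of words depend only on the kernel of the index function. -/
theorem map_word_eq {n : ℕ} (h h' : Fin n → ℕ) (hh : ∀ i j, h i = h j ↔ h' i = h' j)
    (X : Fin n → A) : Φ (S.word h X) = Φ (S.word h' X) := by
  classical
  obtain ⟨g, hg⟩ : ∃ g : ℕ → ℕ, ∀ i, g (h i) = h' i := by
    refine ⟨fun k => if H : ∃ i, h i = k then h' H.choose else 0, fun i => ?_⟩
    have H : ∃ j, h j = h i := ⟨i, rfl⟩
    simp only [dif_pos H]
    exact (hh _ _).1 H.choose_spec
  obtain ⟨σ, hσ⟩ := exists_perm_eqOn (Finset.univ.image h) g (by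
    intro a ha b hb hab
    simp only [Finset.coe_image, Finset.coe_univ, Set.image_univ, Set.mem_range] at ha hb
    obtain ⟨i, rfl⟩ := ha
    obtain ⟨j, rfl⟩ := hb
    rw [hg, hg] at hab
    exact (hh _ _).2 hab)
  have : h' = fun j => σ (h j) := by
    funext j
    rw [hσ _ (by simp), hg]
  rw [this]
  exact (S.exchangeable n X h σ).symm

/-- The star-subalgebra of `U × U` generated by the pairs `(a^(k), a^(l))` with `R k l`. -/
def relabelPairs (R : ℕ → ℕ → Prop) : StarSubalgebra ℂ (U × U) :=
  StarAlgebra.adjoin ℂ {p | ∃ k l a, R k l ∧ p = (S.ι k a, S.ι l a)}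

theorem ι_mem_relabelPairs {R : ℕ → ℕ → Prop} {k l : ℕ} (h : R k l) (a : A) :
    (S.ι k a, S.ι l a) ∈ S.relabelPairs R :=
  StarAlgebra.subset_adjoin ℂ _ ⟨k, l, a, h, rfl⟩

/-- Exchangeability for arbitrary elements of the generated algebra: relabelling the indices by a
partial bijection does not change the expectation. -/
theorem map_eq_of_mem_relabelPairs {R : ℕ → ℕ → Prop} (hR : IsPartialBijection R) {x y : U}
    (h : (x, y) ∈ S.relabelPairs R) : Φ x = Φ y := by
  suffices H : ∀ p ∈ S.relabelPairs R, Φ p.1 = Φ p.2 from H _ h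
  intro p hp
  have hstar : star {p : U × U | ∃ k l a, R k l ∧ p = (S.ι k a, S.ι l a)} ⊆
      {p : U × U | ∃ k l a, R k l ∧ p = (S.ι k a, S.ι l a)} := by
    rintro p ⟨k, l, a, hkl, hp⟩
    refine ⟨k, l, star a, hkl, ?_⟩
    rw [← star_star p, hp, map_star, map_star]
    rfl
  rw [relabelPairs, ← StarSubalgebra.mem_toSubalgebra, StarAlgebra.adjoin_toSubalgebra,
    Set.union_eq_self_of_subset_right hstar, ← Subalgebra.mem_toSubmodule,
    Algebra.adjoin_eq_span] at hp
  induction hp using Submodule.span_induction with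
  | zero => simp
  | add p q _ _ hp hq => simp [hp, hq]
  | smul c p _ hp => simp [hp]
  | mem p hp =>
    obtain ⟨l, hl, rfl⟩ := Submonoid.exists_list_of_mem_closure hp
    choose! k k' a hR' hp' using hl
    have hfst : (l.prod).1 = S.word (fun j => k (l.get j)) (fun j => a (l.get j)) := by
      rw [word, ← MonoidHom.coe_fst, map_list_prod]
      congr 1
      apply List.ext_get
      · simp
      · intro n h1 h2
        simp only [List.get_eq_getElem, List.getElem_map, List.getElem_ofFn]
        exact congrArg Prod.fst (hp' _ (List.getElem_mem _))
    have hsnd : (l.prod).2 = S.word (fun j => k' (l.get j)) (fun j => a (l.get j)) := by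
      rw [word, ← MonoidHom.coe_snd, map_list_prod]
      congr 1
      apply List.ext_get
      · simp
      · intro n h1 h2
        simp only [List.get_eq_getElem, List.getElem_map, List.getElem_ofFn]
        exact congrArg Prod.snd (hp' _ (List.getElem_mem _))
    rw [hfst, hsnd]
    exact S.map_word_eq _ _ (fun i j => hR _ _ _ _ (hR' _ (List.get_mem _ _))
      (hR' _ (List.get_mem _ _))) _

/-- The state of the exchangeability system is faithful, and the `A_k` generate the algebra. -/
class IsReduced : Prop where
  faithful : IsFaithful Φ
  generated_eq_top : S.generated = ⊤

section Reduced

variable [hS : S.IsReduced]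

/-- Relabelling is well defined: the star-subalgebra of `U × U` generated by the pairs
`(a^(k), a^(s k))` is the graph of a map, because it contains no pair `(0, y)` with `y ≠ 0`. For
such a pair exchangeability gives `Φ (y* y) = Φ (0* 0) = 0`, and `Φ` is faithful. -/
theorem exists_relabel (s : ℕ ↪ ℕ) : ∃ f : U →⋆ₐ[ℂ] U, ∀ k a, f (S.ι k a) = S.ι (s k) a := by
  let Γ := S.relabelPairs fun k l => s k = l
  have hΓ : IsPartialBijection fun k l => s k = l := by
    rintro k l k' l' rfl rfl
    exact s.injective.eq_iff.symm
  let p₁ : Γ →⋆ₐ[ℂ] U := (StarAlgHom.fst ℂ U U).comp Γ.subtype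
  let p₂ : Γ →⋆ₐ[ℂ] U := (StarAlgHom.snd ℂ U U).comp Γ.subtype
  have hinj : Function.Injective p₁ := by
    rw [injective_iff_map_eq_zero]
    rintro ⟨⟨x, y⟩, hxy⟩ hx
    change x = 0 at hx
    subst hx
    have h2 : (star (0 : U) * 0, star y * y) ∈ Γ := mul_mem (star_mem hxy) hxy
    have := S.map_eq_of_mem_relabelPairs hΓ h2
    rw [mul_zero, map_zero] at this
    have := hS.faithful y this.symm
    subst this
    rfl
  have hsurj : Function.Surjective p₁ := by
    have : p₁.range = ⊤ := by
      rw [eq_top_iff, ← hS.generated_eq_top]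
      refine StarAlgebra.adjoin_le (Set.iUnion_subset fun k => ?_)
      rintro _ ⟨a, rfl⟩
      exact ⟨⟨_, S.ι_mem_relabelPairs (R := fun k l => s k = l) rfl a⟩, rfl⟩
    intro x
    have hx : x ∈ p₁.range := this ▸ StarSubalgebra.mem_top
    exact hx
  let e := StarAlgEquiv.ofBijective p₁ ⟨hinj, hsurj⟩
  refine ⟨p₂.comp (e.symm : U →⋆ₐ[ℂ] Γ), fun k a => ?_⟩
  have : e.symm (S.ι k a) = ⟨(S.ι k a, S.ι (s k) a),
      S.ι_mem_relabelPairs (R := fun k l => s k = l) rfl a⟩ := by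
    rw [StarAlgEquiv.symm_apply_eq]
    rfl
  change p₂ (e.symm (S.ι k a)) = _
  rw [this]
  rfl

/-- The star-endomorphism with `a^(k) ↦ a^(s k)`. -/
def relabel (s : ℕ ↪ ℕ) : U →⋆ₐ[ℂ] U := (S.exists_relabel s).choose

@[simp]
theorem relabel_ι (s : ℕ ↪ ℕ) (k : ℕ) (a : A) : S.relabel s (S.ι k a) = S.ι (s k) a :=
  (S.exists_relabel s).choose_spec k a

end Reduced

/-- The star-subalgebra generated by the `A_k`, `k ∈ J`. -/
def alg (J : Set ℕ) : StarSubalgebra ℂ U :=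
  StarAlgebra.adjoin ℂ {x | ∃ k ∈ J, ∃ a, x = S.ι k a}

theorem ι_mem_alg {J : Set ℕ} {k : ℕ} (hk : k ∈ J) (a : A) : S.ι k a ∈ S.alg J :=
  StarAlgebra.subset_adjoin ℂ _ ⟨k, hk, a, rfl⟩

theorem alg_mono {J K : Set ℕ} (h : J ⊆ K) : S.alg J ≤ S.alg K :=
  StarAlgebra.adjoin_le (by rintro _ ⟨k, hk, a, rfl⟩; exact S.ι_mem_alg (h hk) a)

/-- An element of the generated algebra contains only finitely many indices. -/
theorem exists_finset_mem_alg {J : Set ℕ} {x : U} (hx : x ∈ S.alg J) :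
    ∃ F : Finset ℕ, x ∈ S.alg F := by
  classical
  induction hx using StarAlgebra.adjoin_induction with
  | mem x hx =>
    obtain ⟨k, -, a, rfl⟩ := hx
    exact ⟨{k}, S.ι_mem_alg (by simp) a⟩
  | algebraMap r => exact ⟨∅, algebraMap_mem _ r⟩
  | add x y _ _ hx hy =>
    obtain ⟨F, hF⟩ := hx
    obtain ⟨G, hG⟩ := hy
    exact ⟨F ∪ G, add_mem (S.alg_mono (by simp) hF) (S.alg_mono (by simp) hG)⟩
  | mul x y _ _ hx hy =>
    obtain ⟨F, hF⟩ := hx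
    obtain ⟨G, hG⟩ := hy
    exact ⟨F ∪ G, mul_mem (S.alg_mono (by simp) hF) (S.alg_mono (by simp) hG)⟩
  | star x _ hx => exact hx.imp fun F hF => star_mem hF

section Reduced

variable [hS : S.IsReduced]

theorem mem_alg_univ (x : U) : x ∈ S.alg Set.univ := by
  have : S.generated ≤ S.alg Set.univ := by
    refine StarAlgebra.adjoin_le (Set.iUnion_subset fun k => ?_)
    rintro _ ⟨a, rfl⟩
    exact S.ι_mem_alg (Set.mem_univ _) a
  exact this (hS.generated_eq_top ▸ StarSubalgebra.mem_top)

theorem relabel_relabel_congr {J : Set ℕ} {s t r : ℕ ↪ ℕ} (h : ∀ k ∈ J, t (s k) = r k) {x : U}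
    (hx : x ∈ S.alg J) : S.relabel t (S.relabel s x) = S.relabel r x := by
  refine StarAlgHom.adjoin_le_equalizer ((S.relabel t).comp (S.relabel s)) (S.relabel r) ?_ hx
  rintro _ ⟨k, hk, a, rfl⟩
  simp [h k hk]

theorem relabel_eq_self {J : Set ℕ} {s : ℕ ↪ ℕ} (h : ∀ k ∈ J, s k = k) {x : U}
    (hx : x ∈ S.alg J) : S.relabel s x = x := by
  refine StarAlgHom.adjoin_le_equalizer (S.relabel s) (StarAlgHom.id ℂ U) ?_ hx
  rintro _ ⟨k, hk, a, rfl⟩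
  simp [h k hk]

theorem relabel_mem_alg {J K : Set ℕ} {s : ℕ ↪ ℕ} (h : ∀ k ∈ J, s k ∈ K) {x : U}
    (hx : x ∈ S.alg J) : S.relabel s x ∈ S.alg K := by
  suffices S.alg J ≤ (S.alg K).comap (S.relabel s) from this hx
  refine StarAlgebra.adjoin_le ?_
  rintro _ ⟨k, hk, a, rfl⟩
  change S.relabel s (S.ι k a) ∈ S.alg K
  rw [relabel_ι]
  exact S.ι_mem_alg (h k hk) a

theorem relabel_pair_mem {R : ℕ → ℕ → Prop} {J : Set ℕ} {s t : ℕ ↪ ℕ}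
    (h : ∀ k ∈ J, R (s k) (t k)) {x : U} (hx : x ∈ S.alg J) :
    (S.relabel s x, S.relabel t x) ∈ S.relabelPairs R := by
  suffices S.alg J ≤ (S.relabelPairs R).comap ((S.relabel s).prod (S.relabel t)) from this hx
  refine StarAlgebra.adjoin_le ?_
  rintro _ ⟨k, hk, a, rfl⟩
  change (S.relabel s (S.ι k a), S.relabel t (S.ι k a)) ∈ S.relabelPairs R
  rw [relabel_ι, relabel_ι]
  exact S.ι_mem_relabelPairs (h k hk) a

theorem map_relabel (s : ℕ ↪ ℕ) (x : U) : Φ (S.relabel s x) = Φ x := by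
  have h := S.relabel_pair_mem (R := fun k l => s k = l) (s := .refl ℕ) (t := s) (fun _ _ => rfl)
    (S.mem_alg_univ x)
  rw [S.relabel_eq_self (J := Set.univ) (fun _ _ => rfl) (S.mem_alg_univ x)] at h
  refine (S.map_eq_of_mem_relabelPairs ?_ h).symm
  rintro k l k' l' rfl rfl
  exact s.injective.eq_iff.symm

/-- An element of the algebra indexed by `J` is the value of a polynomial in letters indexed by
`J`, and relabelling the element amounts to relabelling the letters. -/
theorem exists_eval_eq_relabel {J : Set ℕ} {x : U} (hx : x ∈ S.alg J) :
    ∃ P : FreeAlgebra ℂ (J × A), S.eval Subtype.val P = x ∧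
      ∀ s : ℕ ↪ ℕ, S.eval (fun k : J => s k) P = S.relabel s x := by
  suffices ∃ P : FreeAlgebra ℂ (J × A),
      ∀ s : ℕ ↪ ℕ, S.eval (fun k : J => s k) P = S.relabel s x by
    obtain ⟨P, hP⟩ := this
    refine ⟨P, ?_, hP⟩
    have := hP (.refl ℕ)
    rwa [S.relabel_eq_self (J := J) (fun _ _ => rfl) hx] at this
  rw [alg, ← StarSubalgebra.mem_toSubalgebra, StarAlgebra.adjoin_toSubalgebra,
    Set.union_eq_self_of_subset_right] at hx
  · induction hx using Algebra.adjoin_induction with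
    | mem x hx =>
      obtain ⟨k, hk, a, rfl⟩ := hx
      exact ⟨FreeAlgebra.ι ℂ (⟨k, hk⟩, a), fun s => by simp [eval]⟩
    | algebraMap r =>
      exact ⟨algebraMap ℂ _ r, fun s => by rw [AlgHom.commutes, AlgHomClass.commutes]⟩
    | add x y _ _ hx hy =>
      obtain ⟨P, hP⟩ := hx
      obtain ⟨Q, hQ⟩ := hy
      exact ⟨P + Q, fun s => by rw [map_add, map_add, hP, hQ]⟩
    | mul x y _ _ hx hy =>
      obtain ⟨P, hP⟩ := hx
      obtain ⟨Q, hQ⟩ := hy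
      exact ⟨P * Q, fun s => by rw [map_mul, map_mul, hP, hQ]⟩
  · rintro x ⟨k, hk, a, hx⟩
    exact ⟨k, hk, star a, by rw [← star_star x, hx, map_star]⟩

end Reduced

end ExchangeabilitySystem

/-! ### Real and dummy indices -/

/-- The even numbers serve as real indices. -/
def realIndices : Set ℕ := {n | n % 2 = 0}

/-- The odd numbers serve as dummy indices. -/
def dummyIndices : Set ℕ := {n | n % 2 = 1}

theorem mem_realIndices {n : ℕ} : n ∈ realIndices ↔ n % 2 = 0 := Iff.rfl

theorem mem_dummyIndices {n : ℕ} : n ∈ dummyIndices ↔ n % 2 = 1 := Iff.rfl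

/-- Moves the dummy indices into the left half of the dummy indices. -/
def leftDummy : ℕ ↪ ℕ where
  toFun n := if n % 2 = 0 then n else 2 * n - 1
  inj' m n h := by grind

/-- Moves the dummy indices into the right half of the dummy indices. -/
def rightDummy : ℕ ↪ ℕ where
  toFun n := if n % 2 = 0 then n else 2 * n + 1
  inj' m n h := by grind

/-- Moves the dummy indices into the `i`-th of infinitely many disjoint sets of dummy indices. -/
def pairDummy (i : ℕ) : ℕ ↪ ℕ where
  toFun n := if n % 2 = 0 then n else 2 * Nat.pair i (n / 2) + 1
  inj' m n h := by
    dsimp only at h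
    split_ifs at h
    · exact h
    · omega
    · omega
    · have := (Nat.pair_eq_pair.1 (show Nat.pair i (m / 2) = Nat.pair i (n / 2) by omega)).2
      omega

theorem leftDummy_apply (n : ℕ) : leftDummy n = if n % 2 = 0 then n else 2 * n - 1 := rfl

theorem rightDummy_apply (n : ℕ) : rightDummy n = if n % 2 = 0 then n else 2 * n + 1 := rfl

theorem pairDummy_apply (i n : ℕ) :
    pairDummy i n = if n % 2 = 0 then n else 2 * Nat.pair i (n / 2) + 1 := rfl

theorem pairDummy_eq_iff {i j m n : ℕ} :
    pairDummy i m = pairDummy j n ↔ m = n ∧ (m % 2 = 0 ∨ i = j) := by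
  constructor
  · intro h
    rw [pairDummy_apply, pairDummy_apply] at h
    split_ifs at h
    · omega
    · omega
    · omega
    · have := Nat.pair_eq_pair.1 (show Nat.pair i (m / 2) = Nat.pair j (n / 2) by omega)
      omega
  · rintro ⟨rfl, h | rfl⟩
    · simp [pairDummy_apply, h]
    · rfl

/-- Polarization: a positive functional is hermitian. -/
theorem IsState.map_star {U : Type*} [Ring U] [StarRing U] [Algebra ℂ U] [StarModule ℂ U]
    {Φ : U →ₗ[ℂ] ℂ} (hΦ : IsState Φ) (x : U) : Φ (star x) = star (Φ x) := by
  have h0 := fun y => (Complex.nonneg_iff.1 (hΦ.nonneg y)).2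
  have h1 := h0 (1 + x)
  have h2 := h0 (1 + Complex.I • x)
  have h3 := h0 x
  simp only [star_add, star_one, star_smul, mul_add, add_mul, one_mul, mul_one, map_add, map_smul,
    hΦ.map_one, smul_mul_assoc, mul_smul_comm, smul_eq_mul, RCLike.star_def,
    Complex.conj_I] at h1 h2
  simp at h1 h2
  apply Complex.ext <;> simp <;> linarith

namespace ExchangeabilitySystem

variable {A U : Type*}
  [Ring A] [StarRing A] [Algebra ℂ A] [StarModule ℂ A]
  [Ring U] [StarRing U] [Algebra ℂ U] [StarModule ℂ U]
  {φ : A →ₗ[ℂ] ℂ} {Φ : U →ₗ[ℂ] ℂ} (S : ExchangeabilitySystem φ Φ)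

section Reduced

variable [hS : S.IsReduced]

@[simp]
theorem relabel_relabel (s t : ℕ ↪ ℕ) (x : U) :
    S.relabel t (S.relabel s x) = S.relabel (s.trans t) x :=
  S.relabel_relabel_congr (fun _ _ => rfl) (S.mem_alg_univ x)

theorem relabel_refl (x : U) : S.relabel (.refl ℕ) x = x :=
  S.relabel_eq_self (fun _ _ => rfl) (S.mem_alg_univ x)

end Reduced

/-- The elements that are null when tested against the elements with real indices. -/
def nullSpace : Submodule ℂ U where
  carrier := {x | ∀ u ∈ S.alg realIndices, ∀ v ∈ S.alg realIndices, Φ (u * x * v) = 0}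
  add_mem' {x y} hx hy u hu v hv := by
    rw [mul_add, add_mul, map_add, hx u hu v hv, hy u hu v hv, add_zero]
  zero_mem' u _ v _ := by simp
  smul_mem' c x hx u hu v hv := by
    rw [mul_smul_comm, smul_mul_assoc, map_smul, hx u hu v hv, smul_zero]

/-- Polynomials in letters with real and dummy indices, modulo the null elements. A polynomial in
which the dummy indices `m₁, …, mᵣ` occur represents its average over all values of `m₁, …, mᵣ`,
so that dummy indices in different factors of a product have to be renamed apart. -/
def Envelope : Type _ := U ⧸ S.nullSpace

namespace Envelope

instance : AddCommGroup S.Envelope := inferInstanceAs (AddCommGroup (U ⧸ S.nullSpace))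

instance : Module ℂ S.Envelope := inferInstanceAs (Module ℂ (U ⧸ S.nullSpace))

/-- The class of a polynomial in letters with real and dummy indices. -/
def mk : U →ₗ[ℂ] S.Envelope := S.nullSpace.mkQ

theorem mk_surjective : Function.Surjective (mk S) := S.nullSpace.mkQ_surjective

theorem mk_eq_zero {x : U} : mk S x = 0 ↔ x ∈ S.nullSpace := Submodule.Quotient.mk_eq_zero _

theorem mk_eq_mk {x y : U} : mk S x = mk S y ↔ x - y ∈ S.nullSpace := Submodule.Quotient.eq _

end Envelope

theorem star_mem_nullSpace {x : U} (hx : x ∈ S.nullSpace) : star x ∈ S.nullSpace := by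
  intro u hu v hv
  have := hx _ (star_mem hv) _ (star_mem hu)
  rw [← star_star (Φ _), ← S.isState.map_star, star_mul, star_mul, star_star, ← mul_assoc, this,
    star_zero]

theorem mem_relabelPairs_of_mem_alg {R : ℕ → ℕ → Prop} {J : Set ℕ} (h : ∀ k ∈ J, R k k) {x : U}
    (hx : x ∈ S.alg J) : (x, x) ∈ S.relabelPairs R := by
  suffices S.alg J ≤ (S.relabelPairs R).comap ((StarAlgHom.id ℂ U).prod (StarAlgHom.id ℂ U)) from
    this hx
  refine StarAlgebra.adjoin_le ?_
  rintro _ ⟨k, hk, a, rfl⟩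
  exact S.ι_mem_relabelPairs (h k hk) a

namespace Envelope

/-- Renaming the dummy indices of a polynomial does not change its class. -/
theorem mk_eq_mk_of_mem_relabelPairs {R : ℕ → ℕ → Prop} (hR : IsPartialBijection R)
    (hreal : ∀ k ∈ realIndices, R k k) {x y : U} (h : (x, y) ∈ S.relabelPairs R) :
    mk S x = mk S y := by
  rw [mk_eq_mk]
  intro u hu v hv
  rw [mul_sub, sub_mul, map_sub, sub_eq_zero]
  exact S.map_eq_of_mem_relabelPairs hR (mul_mem (mul_mem
    (S.mem_relabelPairs_of_mem_alg hreal hu) h) (S.mem_relabelPairs_of_mem_alg hreal hv))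

end Envelope

variable [hS : S.IsReduced]

/-- The null space is invariant under injective relabellings of the real indices. A null element
contains only finitely many indices, so that the relabelling may be assumed to be bijective. -/
theorem relabel_mem_nullSpace_of_real {s : ℕ ↪ ℕ} (hreal : ∀ n ∈ realIndices, s n ∈ realIndices)
    (hdummy : ∀ n ∈ dummyIndices, s n = n) {x : U} (hx : x ∈ S.nullSpace) :
    S.relabel s x ∈ S.nullSpace := by
  intro u hu v hv
  obtain ⟨F, hF⟩ := S.exists_finset_mem_alg (S.mem_alg_univ x)
  obtain ⟨π, hπ⟩ := exists_perm_eqOn (F.image (· / 2)) (fun k => s (2 * k) / 2) (by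
    intro a _ b _ hab
    have ha := hreal (2 * a) (by simp [mem_realIndices])
    have hb := hreal (2 * b) (by simp [mem_realIndices])
    rw [mem_realIndices] at ha hb
    dsimp only at hab
    have := s.injective (show s (2 * a) = s (2 * b) by omega)
    omega)
  -- `w` undoes `s` on the finitely many indices of `x` and keeps real indices real
  let w : ℕ ↪ ℕ := ⟨fun n => if n % 2 = 0 then 2 * π.symm (n / 2) else n, by
    intro m n h
    dsimp only at h
    split_ifs at h
    · have := π.symm.injective (show π.symm (m / 2) = π.symm (n / 2) by omega)
      omega
    · omega
    · omega
    · exact h⟩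
  have hwa : ∀ n, w n = if n % 2 = 0 then 2 * π.symm (n / 2) else n := fun _ => rfl
  have hw : ∀ n ∈ realIndices, w n ∈ realIndices := by
    intro n hn
    rw [mem_realIndices] at hn ⊢
    rw [hwa, if_pos hn]
    omega
  have hws : ∀ n ∈ (F : Set ℕ), w (s n) = n := by
    intro n hn
    rcases Nat.mod_two_eq_zero_or_one n with h0 | h1
    · have h2 := hreal n h0
      have h3 : 2 * (n / 2) = n := by omega
      have h4 := hπ (n / 2) (Finset.mem_image_of_mem _ hn)
      rw [mem_realIndices] at h2
      rw [h3] at h4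
      rw [hwa, if_pos h2, ← h4, Equiv.symm_apply_apply]
      omega
    · rw [hdummy n h1]
      rw [hwa, if_neg (by omega)]
  have hxx : S.relabel w (S.relabel s x) = x := by
    rw [S.relabel_relabel_congr (r := .refl ℕ) hws hF, relabel_refl]
  rw [← S.map_relabel w, map_mul (S.relabel w), map_mul (S.relabel w), hxx]
  exact hx _ (S.relabel_mem_alg hw hu) _ (S.relabel_mem_alg hw hv)

/-- A null element may be tested against elements with arbitrary indices, as long as these do not
contain its dummy indices. -/
theorem map_mul_relabel_mul_eq_zero {x y z : U} {J : Set ℕ} {s : ℕ ↪ ℕ} (hx : x ∈ S.nullSpace)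
    (hy : y ∈ S.alg J) (hz : z ∈ S.alg J) (hJ : ∀ n ∈ dummyIndices, s n ∉ J) :
    Φ (y * S.relabel s x * z) = 0 := by
  classical
  -- `t` moves the dummy indices of `x` back to their original places, and all other indices to
  -- real ones: those of the form `s i` to multiples of `4`, the remaining ones to `4 j + 2`
  let d : ℕ ↪ ℕ := ⟨fun n => if n % 2 = 0 then 2 * n else n, by intro m n h; grind⟩
  have hd : ∀ n, d n = if n % 2 = 0 then 2 * n else n := fun _ => rfl
  let t' : ℕ → ℕ := fun j => if h : ∃ i, s i = j then d h.choose else 4 * j + 2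
  have ht1 : ∀ i, t' (s i) = d i := by
    intro i
    have h : ∃ i', s i' = s i := ⟨i, rfl⟩
    simp only [t', dif_pos h]
    rw [s.injective h.choose_spec]
  have ht2 : ∀ j, (¬ ∃ i, s i = j) → t' j = 4 * j + 2 := fun j hj => dif_neg hj
  let t : ℕ ↪ ℕ := ⟨t', by
    intro j k hjk
    by_cases hj : ∃ i, s i = j <;> by_cases hk : ∃ i, s i = k
    · obtain ⟨i, rfl⟩ := hj
      obtain ⟨i', rfl⟩ := hk
      rw [ht1, ht1] at hjk
      rw [d.injective hjk]
    · obtain ⟨i, rfl⟩ := hj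
      rw [ht1, ht2 k hk, hd] at hjk
      grind
    · obtain ⟨i, rfl⟩ := hk
      rw [ht1, ht2 j hj, hd] at hjk
      grind
    · rw [ht2 j hj, ht2 k hk] at hjk
      omega⟩
  have htJ : ∀ j ∈ J, t j ∈ realIndices := by
    intro j hj
    change t' j % 2 = 0
    by_cases h : ∃ i, s i = j
    · obtain ⟨i, rfl⟩ := h
      rcases Nat.mod_two_eq_zero_or_one i with h0 | h1
      · rw [ht1, hd, if_pos h0]
        omega
      · exact absurd hj (hJ i h1)
    · rw [ht2 j h]
      omega
  have htx : S.relabel t (S.relabel s x) = S.relabel d x :=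
    S.relabel_relabel_congr (J := Set.univ) (fun i _ => ht1 i) (S.mem_alg_univ x)
  rw [← S.map_relabel t, map_mul (S.relabel t), map_mul (S.relabel t), htx]
  refine S.relabel_mem_nullSpace_of_real ?_ ?_ hx _ (S.relabel_mem_alg htJ hy) _
    (S.relabel_mem_alg htJ hz)
  · intro n hn
    rw [mem_realIndices] at hn ⊢
    rw [hd, if_pos hn]
    omega
  · intro n hn
    rw [mem_dummyIndices] at hn
    rw [hd, if_neg (by omega)]

/-- The null space is invariant under all relabellings that keep dummy indices dummy. -/
theorem relabel_mem_nullSpace {s : ℕ ↪ ℕ} (hs : ∀ n ∈ dummyIndices, s n ∈ dummyIndices) {x : U}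
    (hx : x ∈ S.nullSpace) : S.relabel s x ∈ S.nullSpace := by
  intro u hu v hv
  refine S.map_mul_relabel_mul_eq_zero hx hu hv fun n hn h => ?_
  have := hs n hn
  rw [mem_dummyIndices] at this; rw [mem_realIndices] at h
  omega

end ExchangeabilitySystem

/-- If `n d + (n² - n) c ≥ 0` for all `n`, then the coefficient `c` of the leading term is
nonnegative. -/
theorem nonneg_of_forall_mul_add_nonneg {c d : ℂ} (hd : 0 ≤ d)
    (h : ∀ n : ℕ, 0 ≤ n * d + (n * n - n) * c) : 0 ≤ c := by
  rw [Complex.nonneg_iff] at hd ⊢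
  have hre : ∀ n : ℕ, 0 ≤ n * d.re + (n * n - n) * c.re := by
    intro n
    simpa using (Complex.nonneg_iff.1 (h n)).1
  have him := (Complex.nonneg_iff.1 (h 2)).2
  have him' : c.im = 0 := by
    simp [← hd.2] at him
    norm_num at him
    exact him
  refine ⟨?_, him'.symm⟩
  by_contra! hc
  obtain ⟨n, hn⟩ := exists_nat_gt (d.re / -c.re)
  rw [div_lt_iff₀ (by linarith)] at hn
  have := hre (n + 1)
  push_cast at this
  nlinarith [mul_nonneg (Nat.cast_nonneg (α := ℝ) n) hd.1]

namespace ExchangeabilitySystem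

variable {A U : Type*}
  [Ring A] [StarRing A] [Algebra ℂ A] [StarModule ℂ A]
  [Ring U] [StarRing U] [Algebra ℂ U] [StarModule ℂ U]
  {φ : A →ₗ[ℂ] ℂ} {Φ : U →ₗ[ℂ] ℂ} (S : ExchangeabilitySystem φ Φ)

/-! ### The star-algebra of averaged polynomials -/

variable {S} in
theorem mul_mem_relabelPairs {R : ℕ → ℕ → Prop} {x y x' y' : U} (h : (x, y) ∈ S.relabelPairs R)
    (h' : (x', y') ∈ S.relabelPairs R) : (x * x', y * y') ∈ S.relabelPairs R :=
  mul_mem h h'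

namespace Envelope

instance : One S.Envelope := ⟨mk S 1⟩

theorem mk_one : mk S 1 = 1 := rfl

instance : Star S.Envelope where
  star := Quotient.map star (by
    intro x x' hx
    rw [← Quotient.eq_iff_equiv] at hx ⊢
    refine (mk_eq_mk S).2 ?_
    rw [← star_sub]
    exact S.star_mem_nullSpace ((mk_eq_mk S).1 hx))

theorem star_mk (x : U) : star (mk S x) = mk S (star x) := rfl

end Envelope

variable [hS : S.IsReduced]

theorem relabel_pair_mem_univ {R : ℕ → ℕ → Prop} {s t : ℕ ↪ ℕ} (h : ∀ k, R (s k) (t k)) (x : U) :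
    (S.relabel s x, S.relabel t x) ∈ S.relabelPairs R :=
  S.relabel_pair_mem (fun k _ => h k) (S.mem_alg_univ x)

/-- The product of polynomials after renaming their dummy indices apart. -/
def disjointMul (x y : U) : U := S.relabel leftDummy x * S.relabel rightDummy y

theorem disjointMul_mem_nullSpace_left {x : U} (hx : x ∈ S.nullSpace) (y : U) :
    S.disjointMul x y ∈ S.nullSpace := by
  intro u hu v hv
  let J : Set ℕ := {n | n % 2 = 0 ∨ n % 4 = 3}
  have hreal : realIndices ⊆ J := fun n hn => Or.inl hn
  rw [disjointMul, ← mul_assoc, mul_assoc]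
  refine S.map_mul_relabel_mul_eq_zero (J := J) hx (S.alg_mono hreal hu)
    (mul_mem (S.relabel_mem_alg (fun n _ => ?_) (S.mem_alg_univ y)) (S.alg_mono hreal hv)) ?_
  · change _ ∨ _
    rw [rightDummy_apply]
    split_ifs <;> omega
  · intro n hn h
    change _ ∨ _ at h
    rw [mem_dummyIndices] at hn
    rw [leftDummy_apply, if_neg (by omega)] at h
    omega

theorem disjointMul_mem_nullSpace_right (x : U) {y : U} (hy : y ∈ S.nullSpace) :
    S.disjointMul x y ∈ S.nullSpace := by
  intro u hu v hv
  let J : Set ℕ := {n | n % 2 = 0 ∨ n % 4 = 1}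
  have hreal : realIndices ⊆ J := fun n hn => Or.inl hn
  rw [disjointMul, ← mul_assoc]
  refine S.map_mul_relabel_mul_eq_zero (J := J) hy (mul_mem (S.alg_mono hreal hu)
    (S.relabel_mem_alg (fun n _ => ?_) (S.mem_alg_univ x))) (S.alg_mono hreal hv) ?_
  · change _ ∨ _
    rw [leftDummy_apply]
    split_ifs <;> omega
  · intro n hn h
    change _ ∨ _ at h
    rw [mem_dummyIndices] at hn
    rw [rightDummy_apply, if_neg (by omega)] at h
    omega

namespace Envelope

instance : Mul S.Envelope where
  mul := Quotient.map₂ S.disjointMul (by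
    intro x x' hx y y' hy
    rw [← Quotient.eq_iff_equiv] at hx hy ⊢
    replace hx := (mk_eq_mk S).1 hx
    replace hy := (mk_eq_mk S).1 hy
    refine (mk_eq_mk S).2 ?_
    have : S.disjointMul x y - S.disjointMul x' y' =
        S.disjointMul (x - x') y + S.disjointMul x' (y - y') := by
      simp only [disjointMul, map_sub]
      noncomm_ring
    rw [this]
    exact add_mem (S.disjointMul_mem_nullSpace_left hx y)
      (S.disjointMul_mem_nullSpace_right x' hy))

theorem mk_mul_mk (x y : U) : mk S x * mk S y =
    mk S (S.relabel leftDummy x * S.relabel rightDummy y) := rfl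

/-- The choice of dummy indices in the product of two classes is immaterial: any renaming will do
that preserves real indices and keeps the dummy indices of the two factors apart. -/
theorem mk_mul_mk_of_rel {R : ℕ → ℕ → Prop} (hR : IsPartialBijection R)
    (hreal : ∀ k ∈ realIndices, R k k) {x y x' y' : U}
    (hx : (S.relabel leftDummy x, x') ∈ S.relabelPairs R)
    (hy : (S.relabel rightDummy y, y') ∈ S.relabelPairs R) :
    mk S x * mk S y = mk S (x' * y') :=
  mk_eq_mk_of_mem_relabelPairs S hR hreal (mul_mem hx hy)

/-- Relabellings that fix the real indices act trivially on classes. -/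
theorem mk_relabel_eq_mk {s : ℕ ↪ ℕ} (hs : ∀ n ∈ realIndices, s n = n) {x : U} :
    mk S (S.relabel s x) = mk S x := by
  refine (mk_eq_mk_of_mem_relabelPairs S (R := fun k l => s k = l) ?_ hs ?_).symm
  · rintro k l k' l' rfl rfl
    exact s.injective.eq_iff.symm
  · have := S.relabel_pair_mem_univ (R := fun k l => s k = l) (s := .refl ℕ) (t := s)
      (fun _ => rfl) x
    rwa [relabel_refl] at this

instance : Ring S.Envelope :=
  { (inferInstance : AddCommGroup S.Envelope) with
    left_distrib := by
      intro a b c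
      obtain ⟨x, rfl⟩ := mk_surjective S a
      obtain ⟨y, rfl⟩ := mk_surjective S b
      obtain ⟨z, rfl⟩ := mk_surjective S c
      change mk S x * (mk S y + mk S z) = mk S x * mk S y + mk S x * mk S z
      rw [← map_add, mk_mul_mk, mk_mul_mk, mk_mul_mk, ← map_add, map_add, mul_add]
    right_distrib := by
      intro a b c
      obtain ⟨x, rfl⟩ := mk_surjective S a
      obtain ⟨y, rfl⟩ := mk_surjective S b
      obtain ⟨z, rfl⟩ := mk_surjective S c
      change (mk S x + mk S y) * mk S z = mk S x * mk S z + mk S y * mk S z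
      rw [← map_add, mk_mul_mk, mk_mul_mk, mk_mul_mk, ← map_add, map_add, add_mul]
    zero_mul := by
      intro a
      obtain ⟨x, rfl⟩ := mk_surjective S a
      change mk S 0 * mk S x = mk S 0
      rw [mk_mul_mk, map_zero, zero_mul]
    mul_zero := by
      intro a
      obtain ⟨x, rfl⟩ := mk_surjective S a
      change mk S x * mk S 0 = mk S 0
      rw [mk_mul_mk, map_zero, mul_zero]
    mul_assoc := by
      intro a b c
      obtain ⟨x, rfl⟩ := mk_surjective S a
      obtain ⟨y, rfl⟩ := mk_surjective S b
      obtain ⟨z, rfl⟩ := mk_surjective S c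
      rw [mk_mul_mk, mk_mul_mk, mk_mul_mk, mk_mul_mk]
      simp only [map_mul, relabel_relabel, ← mul_assoc]
      -- the dummy indices `8m + 1`, `8m + 5`, `4m + 3` of the three factors on the left become
      -- `4m + 1`, `8m + 3`, `8m + 7` on the right
      refine mk_eq_mk_of_mem_relabelPairs S (R := fun k l => (k % 2 = 0 ∧ l = k) ∨
        (k % 8 = 1 ∧ k + 1 = 2 * l) ∨ (k % 8 = 5 ∧ l + 2 = k) ∨ (k % 4 = 3 ∧ l = 2 * k + 1))
        ?_ ?_ (mul_mem_relabelPairs (mul_mem_relabelPairs ?_ ?_) ?_)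
      · intro k l k' l' h h'
        omega
      · intro k hk
        exact Or.inl ⟨hk, rfl⟩
      all_goals
        refine S.relabel_pair_mem_univ (fun k => ?_) _
        simp only [Function.Embedding.trans_apply, leftDummy_apply, rightDummy_apply]
        grind
    one_mul := by
      intro a
      obtain ⟨x, rfl⟩ := mk_surjective S a
      rw [← mk_one, mk_mul_mk, map_one, one_mul]
      exact mk_relabel_eq_mk S fun n hn => if_pos hn
    mul_one := by
      intro a
      obtain ⟨x, rfl⟩ := mk_surjective S a
      rw [← mk_one, mk_mul_mk, map_one, mul_one]
      exact mk_relabel_eq_mk S fun n hn => if_pos hn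
    neg_add_cancel := neg_add_cancel
    zsmul := fun n a => n • a
    zsmul_zero' := fun a => zero_smul ℤ a
    zsmul_succ' := fun n a => SubNegMonoid.zsmul_succ' n a
    zsmul_neg' := fun n a => SubNegMonoid.zsmul_neg' n a }

instance : Algebra ℂ S.Envelope :=
  Algebra.ofModule
    (by
      intro c a b
      obtain ⟨x, rfl⟩ := mk_surjective S a
      obtain ⟨y, rfl⟩ := mk_surjective S b
      rw [← map_smul, mk_mul_mk, mk_mul_mk, ← map_smul, map_smul, smul_mul_assoc])
    (by
      intro c a b
      obtain ⟨x, rfl⟩ := mk_surjective S a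
      obtain ⟨y, rfl⟩ := mk_surjective S b
      rw [← map_smul, mk_mul_mk, mk_mul_mk, ← map_smul, map_smul, mul_smul_comm])

instance : StarRing S.Envelope where
  star_involutive a := by
    obtain ⟨x, rfl⟩ := mk_surjective S a
    rw [star_mk, star_mk, star_star]
  star_mul a b := by
    obtain ⟨x, rfl⟩ := mk_surjective S a
    obtain ⟨y, rfl⟩ := mk_surjective S b
    -- the two halves of the dummy indices are exchanged
    rw [mk_mul_mk, star_mk, star_mk, star_mk, mk_mul_mk, star_mul, ← map_star, ← map_star]
    refine mk_eq_mk_of_mem_relabelPairs S (R := fun k l => (k % 2 = 0 ∧ l = k) ∨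
      (k % 4 = 1 ∧ l = k + 2) ∨ (k % 4 = 3 ∧ k = l + 2)) ?_ ?_ (mul_mem_relabelPairs ?_ ?_)
    · intro k l k' l' h h'
      omega
    · intro k hk
      exact Or.inl ⟨hk, rfl⟩
    all_goals
      refine S.relabel_pair_mem_univ (fun k => ?_) _
      simp only [leftDummy_apply, rightDummy_apply]
      grind
  star_add a b := by
    obtain ⟨x, rfl⟩ := mk_surjective S a
    obtain ⟨y, rfl⟩ := mk_surjective S b
    rw [← map_add, star_mk, star_mk, star_mk, star_add, map_add]

instance : StarModule ℂ S.Envelope where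
  star_smul c a := by
    obtain ⟨x, rfl⟩ := mk_surjective S a
    rw [← map_smul, star_mk, star_mk, star_smul, map_smul]

/-! ### The state -/

/-- The state induced by `Φ`. -/
def state : S.Envelope →ₗ[ℂ] ℂ :=
  S.nullSpace.liftQ Φ fun x hx => by simpa using hx 1 (one_mem _) 1 (one_mem _)

@[simp]
theorem state_mk (x : U) : state S (mk S x) = Φ x := rfl

/-- Positivity of the state: `Φ (x* x)` for the average of `n` copies of `x` with disjoint dummy
indices differs from the value of the state only by terms of order `1 / n`. -/
theorem isState_state : IsState (state S) where
  map_one := by rw [← mk_one, state_mk, S.isState.map_one]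
  nonneg a := by
    obtain ⟨x, rfl⟩ := mk_surjective S a
    rw [star_mk, mk_mul_mk, state_mk]
    refine nonneg_of_forall_mul_add_nonneg (S.isState.nonneg x) fun n => ?_
    have hdiag : ∀ i, Φ (star (S.relabel (pairDummy i) x) * S.relabel (pairDummy i) x) =
        Φ (star x * x) := by
      intro i
      rw [← map_star, ← map_mul, S.map_relabel]
    have hoff : ∀ i j, i ≠ j →
        Φ (star (S.relabel (pairDummy i) x) * S.relabel (pairDummy j) x) =
          Φ (S.relabel leftDummy (star x) * S.relabel rightDummy x) := by
      intro i j hij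
      rw [← map_star]
      refine S.map_eq_of_mem_relabelPairs (R := fun k l => ∃ m,
        (k = pairDummy i m ∧ l = leftDummy m) ∨ (k = pairDummy j m ∧ l = rightDummy m)) ?_
        (mul_mem_relabelPairs (S.relabel_pair_mem_univ (fun k => ⟨k, Or.inl ⟨rfl, rfl⟩⟩) _)
          (S.relabel_pair_mem_univ (fun k => ⟨k, Or.inr ⟨rfl, rfl⟩⟩) _))
      rintro _ _ _ _ ⟨m, ⟨rfl, rfl⟩ | ⟨rfl, rfl⟩⟩ ⟨m', ⟨rfl, rfl⟩ | ⟨rfl, rfl⟩⟩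
      · rw [EmbeddingLike.apply_eq_iff_eq, EmbeddingLike.apply_eq_iff_eq]
      · rw [pairDummy_eq_iff, leftDummy_apply, rightDummy_apply]
        grind
      · rw [pairDummy_eq_iff, leftDummy_apply, rightDummy_apply]
        grind
      · rw [EmbeddingLike.apply_eq_iff_eq, EmbeddingLike.apply_eq_iff_eq]
    have hsum := S.isState.nonneg (∑ i ∈ Finset.range n, S.relabel (pairDummy i) x)
    rw [star_sum, Finset.sum_mul_sum, map_sum] at hsum
    convert hsum using 1
    have : ∀ i ∈ Finset.range n,
        Φ (∑ j ∈ Finset.range n, star (S.relabel (pairDummy i) x) * S.relabel (pairDummy j) x) =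
          Φ (star x * x) + (n - 1) * Φ (S.relabel leftDummy (star x) * S.relabel rightDummy x) := by
      intro i hi
      rw [map_sum, ← Finset.add_sum_erase _ _ hi, hdiag,
        Finset.sum_congr rfl fun j hj => hoff i j (Finset.ne_of_mem_erase hj).symm,
        Finset.sum_const, Finset.card_erase_of_mem hi, Finset.card_range, nsmul_eq_mul,
        Nat.cast_sub (by have := Finset.mem_range.1 hi; omega), Nat.cast_one]
    rw [Finset.sum_congr rfl this, Finset.sum_const, Finset.card_range, nsmul_eq_mul]
    ring

end Envelope
end ExchangeabilitySystem

/-! ### The conditional expectation and the relabelling of real indices -/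

/-- Turns all indices into dummy indices. -/
def toDummy : ℕ ↪ ℕ where
  toFun n := 2 * n + 1
  inj' m n h := by
    dsimp only at h
    omega

/-- The action of an injection on the real indices, with dummy indices fixed. -/
def liftReal (σ : ℕ ↪ ℕ) : ℕ ↪ ℕ where
  toFun n := if n % 2 = 0 then 2 * σ (n / 2) else n
  inj' m n h := by
    dsimp only at h
    split_ifs at h
    · have := σ.injective (show σ (m / 2) = σ (n / 2) by omega)
      omega
    · omega
    · omega
    · exact h

/-- Doubling: identifies all indices with the real indices. -/
def doubling : ℕ ↪ ℕ where
  toFun n := 2 * n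
  inj' m n h := by
    dsimp only at h
    omega

theorem toDummy_apply (n : ℕ) : toDummy n = 2 * n + 1 := rfl

theorem doubling_apply (n : ℕ) : doubling n = 2 * n := rfl

theorem liftReal_apply (σ : ℕ ↪ ℕ) (n : ℕ) :
    liftReal σ n = if n % 2 = 0 then 2 * σ (n / 2) else n := rfl

/-- The real indices `2 k`, `k ∈ K`, and all dummy indices. -/
def indices (K : Set ℕ) : Set ℕ := {n | n % 2 = 0 → n / 2 ∈ K}

theorem mem_indices {K : Set ℕ} {n : ℕ} : n ∈ indices K ↔ (n % 2 = 0 → n / 2 ∈ K) := Iff.rfl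

namespace ExchangeabilitySystem

variable {A U : Type*}
  [Ring A] [StarRing A] [Algebra ℂ A] [StarModule ℂ A]
  [Ring U] [StarRing U] [Algebra ℂ U] [StarModule ℂ U]
  {φ : A →ₗ[ℂ] ℂ} {Φ : U →ₗ[ℂ] ℂ} (S : ExchangeabilitySystem φ Φ)

variable [hS : S.IsReduced]

namespace Envelope

/-- The linear map of the envelope induced by a relabelling that keeps dummy indices dummy. -/
def relabelMap (s : ℕ ↪ ℕ) (hs : ∀ n ∈ dummyIndices, s n ∈ dummyIndices) :
    S.Envelope →ₗ[ℂ] S.Envelope :=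
  S.nullSpace.mapQ S.nullSpace (S.relabel s : U →ₗ[ℂ] U) fun _ hx => S.relabel_mem_nullSpace hs hx

theorem relabelMap_mk (s : ℕ ↪ ℕ) (hs : ∀ n ∈ dummyIndices, s n ∈ dummyIndices) (x : U) :
    relabelMap S s hs (mk S x) = mk S (S.relabel s x) := rfl

/-- The conditional expectation: all real indices are turned into dummy indices. -/
def condExp : S.Envelope →ₗ[ℂ] S.Envelope :=
  relabelMap S toDummy fun n _ => by
    rw [mem_dummyIndices, toDummy_apply]
    omega

theorem condExp_mk (x : U) : condExp S (mk S x) = mk S (S.relabel toDummy x) := rfl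

/-- The star-endomorphism of the envelope that relabels the real indices. -/
def shift (σ : ℕ ↪ ℕ) : S.Envelope →⋆ₐ[ℂ] S.Envelope where
  toFun := relabelMap S (liftReal σ) fun n hn => by
    rw [mem_dummyIndices] at hn ⊢
    rwa [liftReal_apply, if_neg (by omega)]
  map_one' := by rw [← mk_one, relabelMap_mk, map_one]
  map_mul' a b := by
    obtain ⟨x, rfl⟩ := mk_surjective S a
    obtain ⟨y, rfl⟩ := mk_surjective S b
    rw [mk_mul_mk, relabelMap_mk, relabelMap_mk, relabelMap_mk, mk_mul_mk,
      map_mul (S.relabel _), relabel_relabel, relabel_relabel, relabel_relabel, relabel_relabel]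
    congr 4 <;>
    · ext n
      simp only [Function.Embedding.trans_apply, leftDummy_apply, rightDummy_apply, liftReal_apply]
      grind
  map_zero' := map_zero _
  map_add' := map_add _
  commutes' r := by
    rw [Algebra.algebraMap_eq_smul_one, map_smul, ← mk_one, relabelMap_mk, map_one]
  map_star' a := by
    obtain ⟨x, rfl⟩ := mk_surjective S a
    rw [relabelMap_mk, star_mk, star_mk, relabelMap_mk, map_star]

theorem shift_mk (σ : ℕ ↪ ℕ) (x : U) :
    shift S σ (mk S x) = mk S (S.relabel (liftReal σ) x) := rfl

/-- The classes of the polynomials whose real indices lie in `K`. -/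
def sub (K : Set ℕ) : StarSubalgebra ℂ S.Envelope where
  carrier := {a | ∃ x ∈ S.alg (indices K), mk S x = a}
  mul_mem' := by
    rintro _ _ ⟨x, hx, rfl⟩ ⟨y, hy, rfl⟩
    refine ⟨_, mul_mem (S.relabel_mem_alg (fun n hn => ?_) hx)
      (S.relabel_mem_alg (fun n hn => ?_) hy), (mk_mul_mk S x y).symm⟩
    · rw [mem_indices] at hn ⊢
      rw [leftDummy_apply]
      grind
    · rw [mem_indices] at hn ⊢
      rw [rightDummy_apply]
      grind
  add_mem' := by
    rintro _ _ ⟨x, hx, rfl⟩ ⟨y, hy, rfl⟩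
    exact ⟨_, add_mem hx hy, map_add _ _ _⟩
  algebraMap_mem' r := by
    refine ⟨algebraMap ℂ U r, algebraMap_mem _ r, ?_⟩
    rw [Algebra.algebraMap_eq_smul_one, map_smul, mk_one, Algebra.algebraMap_eq_smul_one]
  star_mem' := by
    rintro _ ⟨x, hx, rfl⟩
    exact ⟨_, star_mem hx, (star_mk S x).symm⟩

variable {S}

theorem mk_mem_sub {K : Set ℕ} {x : U} (hx : x ∈ S.alg (indices K)) : mk S x ∈ sub S K :=
  ⟨x, hx, rfl⟩

theorem sub_mono {K L : Set ℕ} (h : K ⊆ L) : sub S K ≤ sub S L := by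
  rintro _ ⟨x, hx, rfl⟩
  exact mk_mem_sub (S.alg_mono (fun _ (hn : _ → _) h0 => h (hn h0)) hx)

theorem condExp_mem (a : S.Envelope) : condExp S a ∈ sub S ∅ := by
  obtain ⟨x, rfl⟩ := mk_surjective S a
  refine mk_mem_sub (S.relabel_mem_alg (fun n _ => ?_) (S.mem_alg_univ x))
  rw [mem_indices, toDummy_apply]
  omega

/-- The conditional expectation only renames the dummy indices of an element without real
indices. -/
theorem condExp_of_mem {b : S.Envelope} (hb : b ∈ sub S ∅) : condExp S b = b := by
  obtain ⟨x, hx, rfl⟩ := hb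
  refine mk_eq_mk_of_mem_relabelPairs S (R := fun k l => (k % 2 = 0 ∧ k = l) ∨
    (l % 2 = 1 ∧ k = 2 * l + 1)) ?_ ?_ ?_
  · intro k l k' l' h h'
    omega
  · intro k hk
    exact Or.inl ⟨hk, rfl⟩
  · have := S.relabel_pair_mem (R := fun k l => (k % 2 = 0 ∧ k = l) ∨
      (l % 2 = 1 ∧ k = 2 * l + 1)) (s := toDummy) (t := .refl ℕ) (fun k hk => ?_) hx
    · rwa [relabel_refl] at this
    · rw [mem_indices] at hk
      simp only [Set.mem_empty_iff_false, imp_false, Nat.mod_two_not_eq_zero] at hk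
      exact Or.inr ⟨hk, rfl⟩

theorem condExp_mul_mul {b c : S.Envelope} (hb : b ∈ sub S ∅) (hc : c ∈ sub S ∅) (a : S.Envelope) :
    condExp S (b * a * c) = b * condExp S a * c := by
  obtain ⟨y, hy, rfl⟩ := hb
  obtain ⟨z, hz, rfl⟩ := hc
  obtain ⟨x, rfl⟩ := mk_surjective S a
  rw [condExp_mk, mk_mul_mk, mk_mul_mk, mk_mul_mk, mk_mul_mk, condExp_mk]
  simp only [map_mul, relabel_relabel]
  -- only the middle factor contains real indices `2 i`; they become the dummies `4 i + 1` on the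
  -- left and `16 i + 5` on the right, while its dummies become `16 m + 11` and `16 m + 13`
  refine mk_eq_mk_of_mem_relabelPairs S (R := fun k l => (k % 2 = 0 ∧ k = l) ∨
    (k % 16 = 3 ∧ k = 2 * l + 1) ∨ (k % 16 = 11 ∧ l = k + 2) ∨ (k % 4 = 1 ∧ l = 4 * k + 1) ∨
    (k % 8 = 7 ∧ k = 2 * l + 1)) ?_ ?_ (mul_mem_relabelPairs (mul_mem_relabelPairs ?_ ?_) ?_)
  · intro k l k' l' h h'
    omega
  · intro k hk
    exact Or.inl ⟨hk, rfl⟩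
  · refine S.relabel_pair_mem (fun k hk => ?_) hy
    rw [mem_indices] at hk
    simp only [Set.mem_empty_iff_false, imp_false, Nat.mod_two_not_eq_zero] at hk
    simp only [Function.Embedding.trans_apply, leftDummy_apply, toDummy_apply]
    grind
  · refine S.relabel_pair_mem_univ (fun k => ?_) _
    simp only [Function.Embedding.trans_apply, leftDummy_apply, rightDummy_apply, toDummy_apply]
    grind
  · refine S.relabel_pair_mem (fun k hk => ?_) hz
    rw [mem_indices] at hk
    simp only [Set.mem_empty_iff_false, imp_false, Nat.mod_two_not_eq_zero] at hk
    simp only [Function.Embedding.trans_apply, rightDummy_apply, toDummy_apply]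
    grind

theorem condExp_mul_left {b : S.Envelope} (hb : b ∈ sub S ∅) (a : S.Envelope) :
    condExp S (b * a) = b * condExp S a := by
  simpa using condExp_mul_mul hb (one_mem _) a

theorem condExp_mul_right {c : S.Envelope} (hc : c ∈ sub S ∅) (a : S.Envelope) :
    condExp S (a * c) = condExp S a * c := by
  simpa using condExp_mul_mul (one_mem _) hc a

theorem state_condExp (a : S.Envelope) : state S (condExp S a) = state S a := by
  obtain ⟨x, rfl⟩ := mk_surjective S a
  rw [condExp_mk, state_mk, state_mk, S.map_relabel]

theorem condExp_shift (σ : ℕ ↪ ℕ) (a : S.Envelope) : condExp S (shift S σ a) = condExp S a := by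
  obtain ⟨x, rfl⟩ := mk_surjective S a
  rw [shift_mk, condExp_mk, condExp_mk, relabel_relabel]
  refine mk_eq_mk_of_mem_relabelPairs S (R := fun k l => (k % 2 = 0 ∧ k = l) ∨
    ∃ n, k = 2 * liftReal σ n + 1 ∧ l = 2 * n + 1) ?_ ?_
    (S.relabel_pair_mem_univ (fun n => Or.inr ⟨n, rfl, rfl⟩) x)
  · rintro k l k' l' (h | ⟨n, rfl, rfl⟩) (h' | ⟨n', rfl, rfl⟩)
    · omega
    · omega
    · omega
    · have := (liftReal σ).injective.eq_iff (a := n) (b := n')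
      omega
  · intro k hk
    exact Or.inl ⟨hk, rfl⟩

theorem shift_of_mem (σ : ℕ ↪ ℕ) {b : S.Envelope} (hb : b ∈ sub S ∅) : shift S σ b = b := by
  obtain ⟨x, hx, rfl⟩ := hb
  rw [shift_mk, S.relabel_eq_self (fun k hk => ?_) hx]
  rw [mem_indices] at hk
  rw [liftReal_apply, if_neg hk]

theorem shift_mem {σ : ℕ ↪ ℕ} {K L : Set ℕ} (h : ∀ k ∈ K, σ k ∈ L) {a : S.Envelope}
    (ha : a ∈ sub S K) : shift S σ a ∈ sub S L := by
  obtain ⟨x, hx, rfl⟩ := ha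
  refine mk_mem_sub (S.relabel_mem_alg (fun n hn => ?_) hx)
  rw [mem_indices] at hn ⊢
  rw [liftReal_apply]
  intro h0
  split_ifs at h0 ⊢ with h1
  · rw [Nat.mul_div_cancel_left _ two_pos]
    exact h _ (hn h1)
  · exact absurd h0 h1

theorem shift_shift (σ σ' : ℕ ↪ ℕ) (a : S.Envelope) :
    shift S σ' (shift S σ a) = shift S (σ.trans σ') a := by
  obtain ⟨x, rfl⟩ := mk_surjective S a
  rw [shift_mk, shift_mk, shift_mk, relabel_relabel]
  congr 3
  ext n
  simp only [Function.Embedding.trans_apply, liftReal_apply]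
  split_ifs with h1 h2
  · rw [Nat.mul_div_cancel_left _ two_pos]
  · omega
  · rfl

theorem mem_sub_univ (a : S.Envelope) : a ∈ sub S Set.univ := by
  obtain ⟨x, rfl⟩ := mk_surjective S a
  exact mk_mem_sub (S.alg_mono (fun _ _ => fun _ => Set.mem_univ _) (S.mem_alg_univ x))

/-- In expectations between `a` and `b`, the element `E x` may be replaced by a copy of `x` whose
real indices are disjoint from those of `a` and `b`. -/
theorem state_mul_condExp_mul (a x b : S.Envelope) :
    state S (a * condExp S x * b) =
      state S (shift S doubling a * shift S toDummy x * shift S doubling b) := by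
  obtain ⟨y, rfl⟩ := mk_surjective S a
  obtain ⟨x, rfl⟩ := mk_surjective S x
  obtain ⟨z, rfl⟩ := mk_surjective S b
  simp only [condExp_mk, shift_mk, mk_mul_mk, state_mk, map_mul, relabel_relabel]
  -- the real indices `2 i` of the outer factors become `4 i`; those of `x`, which are the dummies
  -- `16 i + 5` on the left, become `4 i + 2`
  refine S.map_eq_of_mem_relabelPairs (R := fun k l => (k % 2 = 0 ∧ l = 2 * k) ∨
    (k % 8 = 1 ∧ k = l) ∨ (k % 4 = 3 ∧ k = l) ∨ (k % 16 = 5 ∧ 4 * l = k + 3) ∨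
    (k % 16 = 13 ∧ 2 * l + 3 = k)) ?_ (mul_mem_relabelPairs (mul_mem_relabelPairs ?_ ?_) ?_)
  · intro k l k' l' h h'
    omega
  all_goals
    refine S.relabel_pair_mem_univ (fun k => ?_) _
    simp only [Function.Embedding.trans_apply, leftDummy_apply, rightDummy_apply, toDummy_apply,
      doubling_apply, liftReal_apply]
    grind

theorem condExp_positive (x y : S.Envelope) :
    0 ≤ state S (star y * condExp S (star x * x) * y) := by
  rw [state_mul_condExp_mul, map_star, map_mul (shift S toDummy), map_star]
  convert (isState_state S).nonneg (shift S toDummy x * shift S doubling y) using 2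
  rw [star_mul]
  simp only [mul_assoc]

/-! ### The embedding of the exchangeability system -/

variable (S) in
/-- The embedding of the exchangeability system into its envelope. -/
def ofReal : U →⋆ₐ[ℂ] S.Envelope where
  toFun x := mk S (S.relabel doubling x)
  map_one' := by rw [map_one, mk_one]
  map_mul' x y := by
    rw [mk_mul_mk, map_mul, relabel_relabel, relabel_relabel]
    congr 4 <;>
    · ext n
      simp only [Function.Embedding.trans_apply, leftDummy_apply, rightDummy_apply, doubling_apply]
      grind
  map_zero' := by rw [map_zero, map_zero]
  map_add' x y := by rw [map_add, map_add]
  commutes' r := by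
    rw [Algebra.algebraMap_eq_smul_one, map_smul, map_smul, map_one, mk_one,
      Algebra.algebraMap_eq_smul_one]
  map_star' x := by rw [star_mk, map_star]

theorem ofReal_apply (x : U) : ofReal S x = mk S (S.relabel doubling x) := rfl

theorem ofReal_ι (k : ℕ) (a : A) : ofReal S (S.ι k a) = mk S (S.ι (2 * k) a) := by
  rw [ofReal_apply, relabel_ι, doubling_apply]

theorem state_ofReal (x : U) : state S (ofReal S x) = Φ x := by
  rw [ofReal_apply, state_mk, S.map_relabel]

theorem ofReal_injective : Function.Injective (ofReal S) := by
  rw [injective_iff_map_eq_zero]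
  intro x hx
  apply hS.faithful
  rw [← state_ofReal (S := S), map_mul (ofReal S), hx, mul_zero, map_zero]

variable (S) in
theorem exists_relabel_doubling {u : U} (hu : u ∈ S.alg realIndices) :
    ∃ x, S.relabel doubling x = u := by
  suffices S.alg realIndices ≤ (S.relabel doubling).range from this hu
  refine StarAlgebra.adjoin_le ?_
  rintro _ ⟨k, hk, a, rfl⟩
  rw [mem_realIndices] at hk
  refine ⟨S.ι (k / 2) a, ?_⟩
  change S.relabel doubling (S.ι (k / 2) a) = _
  rw [relabel_ι, doubling_apply]
  congr 2
  omega

/-- An element of the envelope is determined by its expectations between elements of the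
exchangeability system. -/
theorem eq_zero_of_state {a : S.Envelope}
    (h : ∀ u v, state S (ofReal S u * a * ofReal S v) = 0) : a = 0 := by
  obtain ⟨x, rfl⟩ := mk_surjective S a
  rw [mk_eq_zero]
  intro u hu v hv
  obtain ⟨u, rfl⟩ := exists_relabel_doubling S hu
  obtain ⟨v, rfl⟩ := exists_relabel_doubling S hv
  rw [← h u v]
  simp only [ofReal_apply, mk_mul_mk, state_mk, map_mul, relabel_relabel]
  refine S.map_eq_of_mem_relabelPairs (R := fun k l => (k % 2 = 0 ∧ l = k) ∨
    (k % 2 = 1 ∧ l = 4 * k + 1)) ?_ (mul_mem_relabelPairs (mul_mem_relabelPairs ?_ ?_) ?_)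
  · intro k l k' l' h h'
    omega
  · refine S.relabel_pair_mem_univ (fun k => ?_) _
    simp only [Function.Embedding.trans_apply, leftDummy_apply, doubling_apply]
    grind
  · have := S.relabel_pair_mem_univ (s := .refl ℕ) (t := rightDummy.trans leftDummy)
      (R := fun k l => (k % 2 = 0 ∧ l = k) ∨ (k % 2 = 1 ∧ l = 4 * k + 1)) (fun k => ?_) x
    · rwa [relabel_refl] at this
    · simp only [Function.Embedding.trans_apply, leftDummy_apply, rightDummy_apply,
        Function.Embedding.refl_apply]
      grind
  · refine S.relabel_pair_mem_univ (fun k => ?_) _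
    simp only [Function.Embedding.trans_apply, rightDummy_apply, doubling_apply]
    grind

end Envelope
end ExchangeabilitySystem

namespace ExchangeabilitySystem

variable {A U : Type*}
  [Ring A] [StarRing A] [Algebra ℂ A] [StarModule ℂ A]
  [Ring U] [StarRing U] [Algebra ℂ U] [StarModule ℂ U]
  {φ : A →ₗ[ℂ] ℂ} {Φ : U →ₗ[ℂ] ℂ} (S : ExchangeabilitySystem φ Φ)

variable [hS : S.IsReduced]

namespace Envelope

/-! ### Freeness with amalgamation -/

/-- All real indices, and the dummy indices in the `j`-th set of dummy indices for some `j ≥ a`, in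
the encoding of `pairDummy`. -/
def tailIndices (a : ℕ) : Set ℕ := {n | n % 2 = 1 → a ≤ (Nat.unpair (n / 2)).1}

theorem mem_tailIndices {a n : ℕ} :
    n ∈ tailIndices a ↔ (n % 2 = 1 → a ≤ (Nat.unpair (n / 2)).1) := Iff.rfl

/-- A product of several classes is the class of the product of the representatives, once the
dummy indices of the `j`-th factor are moved to the `j`-th set of dummy indices. -/
theorem prod_ofFn_mk (n a : ℕ) (y : Fin n → U) :
    (List.ofFn fun j => S.relabel (pairDummy (a + j)) (y j)).prod ∈ S.alg (tailIndices a) ∧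
    (List.ofFn fun j => mk S (y j)).prod =
      mk S (List.ofFn fun j => S.relabel (pairDummy (a + j)) (y j)).prod := by
  induction n generalizing a with
  | zero => exact ⟨by simp, by simp [mk_one]⟩
  | succ n ih =>
    obtain ⟨hmem, hmk⟩ := ih (a + 1) fun j => y j.succ
    have hval : ∀ j : Fin n, a + (j.succ : ℕ) = a + 1 + j := fun j => by
      rw [Fin.val_succ]
      omega
    have hsub : tailIndices (a + 1) ⊆ tailIndices a := by
      intro n hn h
      exact (Nat.le_succ a).trans (hn h)
    simp only [List.ofFn_succ, List.prod_cons, hmk, Fin.val_zero, add_zero, hval]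
    refine ⟨mul_mem (S.relabel_mem_alg (fun n _ => ?_) (S.mem_alg_univ _))
      (S.alg_mono hsub hmem), ?_⟩
    · rw [mem_tailIndices, pairDummy_apply]
      split_ifs with h0
      · omega
      · intro _
        rw [show (2 * Nat.pair a (n / 2) + 1) / 2 = Nat.pair a (n / 2) by omega, Nat.unpair_pair]
    · refine mk_mul_mk_of_rel S (R := fun k l => (k % 2 = 0 ∧ l = k) ∨
        (∃ m, k = 4 * m + 1 ∧ l = 2 * Nat.pair a m + 1) ∨
        (k = 2 * l + 1 ∧ l % 2 = 1 ∧ a + 1 ≤ (Nat.unpair (l / 2)).1)) ?_ ?_ ?_ ?_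
      · rintro k l k' l' (h | ⟨m, rfl, rfl⟩ | h) (h' | ⟨m', rfl, rfl⟩ | h')
        · omega
        · omega
        · omega
        · omega
        · have : Nat.pair a m = Nat.pair a m' ↔ m = m' := by simp [Nat.pair_eq_pair]
          omega
        · constructor
          · omega
          · rintro rfl
            rw [show (2 * Nat.pair a m + 1) / 2 = Nat.pair a m by omega, Nat.unpair_pair] at h'
            simp at h'
        · omega
        · constructor
          · omega
          · rintro rfl
            rw [show (2 * Nat.pair a m' + 1) / 2 = Nat.pair a m' by omega, Nat.unpair_pair] at h
            simp at h
        · omega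
      · intro k hk
        exact Or.inl ⟨hk, rfl⟩
      · refine S.relabel_pair_mem_univ (fun k => ?_) _
        rw [leftDummy_apply, pairDummy_apply]
        split_ifs with h0
        · exact Or.inl ⟨h0, rfl⟩
        · exact Or.inr (Or.inl ⟨k / 2, by omega, rfl⟩)
      · have := S.relabel_pair_mem (s := rightDummy) (t := .refl ℕ) (R := fun k l =>
          (k % 2 = 0 ∧ l = k) ∨ (∃ m, k = 4 * m + 1 ∧ l = 2 * Nat.pair a m + 1) ∨
          (k = 2 * l + 1 ∧ l % 2 = 1 ∧ a + 1 ≤ (Nat.unpair (l / 2)).1)) (fun k hk => ?_) hmem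
        · rwa [relabel_refl] at this
        · rw [rightDummy_apply, Function.Embedding.refl_apply]
          split_ifs with h0
          · exact Or.inl ⟨h0, rfl⟩
          · exact Or.inr (Or.inr ⟨rfl, by omega, hk (by omega)⟩)

/-- Weak freeness in the envelope. The dummy indices of each factor are replaced by genuine fresh
indices, which turns a product in the envelope into a product in the exchangeability system. -/
theorem state_prod_ofFn_eq_zero (hfree : S.WeakFreeness) {K : ℕ → Set ℕ}
    (hK : Pairwise fun k l => Disjoint (K k) (K l)) (n : ℕ) (i : Fin (n + 1) → ℕ)
    (hi : ∀ j : Fin n, i j.castSucc ≠ i j.succ) (Y : Fin (n + 1) → S.Envelope)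
    (hY : ∀ j, Y j ∈ sub S (K (i j))) (hE : ∀ j, condExp S (Y j) = 0) :
    state S (List.ofFn Y).prod = 0 := by
  choose y hy hyY using hY
  obtain rfl : (fun j => mk S (y j)) = Y := funext hyY
  rw [(prod_ofFn_mk S _ 0 y).2, state_mk]
  simp only [zero_add]
  -- `I k` consists of the real indices from `K k` and the dummy indices of all factors labelled `k`
  let I : ℕ → Set ℕ := fun lab => {m | (m % 2 = 0 ∧ m / 2 ∈ K lab) ∨
    (m % 2 = 1 ∧ ∃ j : Fin (n + 1), i j = lab ∧ (Nat.unpair (m / 2)).1 = j)}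
  have hI : Pairwise fun k l => Disjoint (I k) (I l) := by
    intro k l hkl
    rw [Set.disjoint_left]
    rintro m (⟨h0, hm⟩ | ⟨h1, j, hj, hm⟩) (⟨h0', hm'⟩ | ⟨h1', j', hj', hm'⟩)
    · exact Set.disjoint_left.1 (hK hkl) hm hm'
    · omega
    · omega
    · rw [hm] at hm'
      have := Fin.ext hm'
      subst this
      exact hkl (hj.symm.trans hj')
  have hx : ∀ j, S.relabel (pairDummy j) (y j) ∈ S.alg (I (i j)) := by
    intro j
    refine S.relabel_mem_alg (fun m hm => ?_) (hy j)
    rw [pairDummy_apply]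
    split_ifs with h0
    · exact Or.inl ⟨h0, hm h0⟩
    · refine Or.inr ⟨by omega, j, rfl, ?_⟩
      rw [show (2 * Nat.pair j (m / 2) + 1) / 2 = Nat.pair j (m / 2) by omega, Nat.unpair_pair]
  choose P hP hPs using fun j => S.exists_eval_eq_relabel (hx j)
  -- even and odd numbers provide the two disjoint copies of `I k`
  have := hfree n I i P (fun j k => doubling k) (fun j k => toDummy k) hI hi
    (fun j => doubling.injective.comp Subtype.val_injective)
    (fun j => toDummy.injective.comp Subtype.val_injective)
    (fun j => by
      rw [Set.disjoint_left]
      rintro _ ⟨k, rfl⟩ ⟨l, hl⟩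
      simp only [doubling_apply, toDummy_apply] at hl
      omega)
    (fun j => by
      rw [hPs, hPs, relabel_relabel, relabel_relabel, ← map_star]
      have h0 : state S (star (condExp S (mk S (y j))) * condExp S (mk S (y j))) = 0 := by
        rw [hE, mul_zero, map_zero]
      rw [condExp_mk, star_mk, mk_mul_mk, state_mk, ← map_star (S.relabel _), relabel_relabel,
        relabel_relabel] at h0
      rw [← h0]
      refine S.map_eq_of_mem_relabelPairs (R := fun k l => ∃ m,
        (k = 2 * pairDummy j m ∧ l = leftDummy (toDummy m)) ∨
        (k = 2 * pairDummy j m + 1 ∧ l = rightDummy (toDummy m))) ?_ (mul_mem_relabelPairs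
          (S.relabel_pair_mem_univ (fun k => ⟨k, Or.inl ⟨rfl, rfl⟩⟩) _)
          (S.relabel_pair_mem_univ (fun k => ⟨k, Or.inr ⟨rfl, rfl⟩⟩) _))
      rintro _ _ _ _ ⟨m, ⟨rfl, rfl⟩ | ⟨rfl, rfl⟩⟩ ⟨m', ⟨rfl, rfl⟩ | ⟨rfl, rfl⟩⟩
      · rw [leftDummy.injective.eq_iff, toDummy.injective.eq_iff,
          ← (pairDummy j).injective.eq_iff (a := m)]
        omega
      · simp only [leftDummy_apply, rightDummy_apply, toDummy_apply]
        grind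
      · simp only [leftDummy_apply, rightDummy_apply, toDummy_apply]
        grind
      · rw [rightDummy.injective.eq_iff, toDummy.injective.eq_iff,
          ← (pairDummy j).injective.eq_iff (a := m)]
        omega)
  simpa only [hP] using this

variable {S}

/-- The list `l` of labelled elements is an alternating list of centred elements: the element with
label `k` only contains real indices from `K k`, and neighbouring labels are different. -/
structure IsAlternating (K : ℕ → Set ℕ) (l : List (ℕ × S.Envelope)) : Prop where
  isChain : (l.map Prod.fst).IsChain (· ≠ ·)
  mem : ∀ p ∈ l, p.2 ∈ sub S (K p.1)
  condExp_eq_zero : ∀ p ∈ l, condExp S p.2 = 0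

theorem state_prod_eq_zero (hfree : S.WeakFreeness) {K : ℕ → Set ℕ}
    (hK : Pairwise fun k l => Disjoint (K k) (K l)) {l : List (ℕ × S.Envelope)} (hl : l ≠ [])
    (h : IsAlternating K l) : state S (l.map Prod.snd).prod = 0 := by
  obtain ⟨n, g, rfl⟩ : ∃ n, ∃ g : Fin (n + 1) → ℕ × S.Envelope, l = List.ofFn g := by
    obtain ⟨n, hn⟩ := Nat.exists_eq_succ_of_ne_zero (fun h0 => hl (List.length_eq_zero_iff.1 h0))
    exact ⟨n, fun j => l.get (j.cast hn.symm), List.ext_get (by simp [hn]) fun k h1 h2 => by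
      rw [List.get_ofFn]
      rfl⟩
  rw [List.map_ofFn]
  refine state_prod_ofFn_eq_zero S hfree hK n (Prod.fst ∘ g) (fun j => ?_) _
    (fun j => h.mem _ (List.mem_ofFn.2 ⟨j, rfl⟩))
    (fun j => h.condExp_eq_zero _ (List.mem_ofFn.2 ⟨j, rfl⟩))
  have := h.isChain
  rw [List.map_ofFn, List.isChain_ofFn] at this
  exact this j (by omega)

/-- Elements without real indices on both sides of an alternating product of centred elements are
absorbed by its first and its last factor, which remain centred. -/
theorem state_mul_prod_mul_eq_zero (hfree : S.WeakFreeness) {K : ℕ → Set ℕ}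
    (hK : Pairwise fun k l => Disjoint (K k) (K l)) {l : List (ℕ × S.Envelope)} (hl : l ≠ [])
    (h : IsAlternating K l) {b c : S.Envelope} (hb : b ∈ sub S ∅) (hc : c ∈ sub S ∅) :
    state S (b * (l.map Prod.snd).prod * c) = 0 := by
  have hleft : ∀ l : List (ℕ × S.Envelope), l ≠ [] → IsAlternating K l →
      state S (b * (l.map Prod.snd).prod) = 0 := by
    intro l hl h
    obtain ⟨p, l, rfl⟩ := List.exists_cons_of_ne_nil hl
    have := state_prod_eq_zero hfree hK (l := (p.1, b * p.2) :: l) (by simp)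
      ⟨h.isChain, ?_, ?_⟩
    · simpa [mul_assoc] using this
    · intro q hq
      rcases List.mem_cons.1 hq with rfl | hq
      · exact mul_mem (sub_mono (Set.empty_subset _) hb) (h.mem p (by simp))
      · exact h.mem q (by simp [hq])
    · intro q hq
      rcases List.mem_cons.1 hq with rfl | hq
      · rw [condExp_mul_left hb, h.condExp_eq_zero p (by simp), mul_zero]
      · exact h.condExp_eq_zero q (by simp [hq])
  obtain rfl | ⟨l, p, rfl⟩ := List.eq_nil_or_concat' l
  · exact absurd rfl hl
  have := hleft (l ++ [(p.1, p.2 * c)]) (by simp) ⟨?_, ?_, ?_⟩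
  · simpa [mul_assoc] using this
  · simpa using h.isChain
  · intro q hq
    rcases List.mem_append.1 hq with hq | hq
    · exact h.mem q (by simp [hq])
    · rw [List.mem_singleton] at hq
      subst hq
      exact mul_mem (h.mem p (by simp)) (sub_mono (Set.empty_subset _) hc)
  · intro q hq
    rcases List.mem_append.1 hq with hq | hq
    · exact h.condExp_eq_zero q (by simp [hq])
    · rw [List.mem_singleton] at hq
      subst hq
      rw [condExp_mul_right hc, h.condExp_eq_zero p (by simp), zero_mul]

theorem condExp_sub_condExp (a : S.Envelope) : condExp S (a - condExp S a) = 0 := by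
  rw [map_sub, condExp_of_mem (condExp_mem a), sub_self]

/-- An alternating product of centred elements has expectation zero between any two elements that
do not share real indices with it: these are decomposed into a centred part, which makes the
product longer, and a part in the range of the conditional expectation. -/
theorem state_mul_prod_mul_eq_zero' (hfree : S.WeakFreeness) {K : ℕ → Set ℕ}
    (hK : Pairwise fun k l => Disjoint (K k) (K l)) {l : List (ℕ × S.Envelope)} (hl : l ≠ [])
    (h : IsAlternating K l) (h0 : ∀ p ∈ l, p.1 ≠ 0) {y z : S.Envelope} (hy : y ∈ sub S (K 0))
    (hz : z ∈ sub S (K 0)) : state S (y * (l.map Prod.snd).prod * z) = 0 := by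
  have hcons : ∀ l : List (ℕ × S.Envelope), IsAlternating K l → (∀ p ∈ l.head?, p.1 ≠ 0) →
      IsAlternating K ((0, y - condExp S y) :: l) := by
    intro l h h0
    refine ⟨?_, ?_, ?_⟩
    · rw [List.map_cons, List.isChain_cons]
      refine ⟨fun k hk => ?_, h.isChain⟩
      rw [List.head?_map, Option.mem_def, Option.map_eq_some_iff] at hk
      obtain ⟨p, hp, rfl⟩ := hk
      exact (h0 p hp).symm
    · intro q hq
      rcases List.mem_cons.1 hq with rfl | hq
      · exact sub_mem hy (sub_mono (Set.empty_subset _) (condExp_mem y))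
      · exact h.mem q hq
    · intro q hq
      rcases List.mem_cons.1 hq with rfl | hq
      · exact condExp_sub_condExp y
      · exact h.condExp_eq_zero q hq
  have hconcat : IsAlternating K (l ++ [(0, z - condExp S z)]) := by
    refine ⟨?_, ?_, ?_⟩
    · rw [List.map_append, List.isChain_append]
      refine ⟨h.isChain, by simp, fun k hk k' hk' => ?_⟩
      simp only [List.map_cons, List.map_nil, List.head?_cons, Option.mem_def,
        Option.some.injEq] at hk'
      subst hk'
      obtain ⟨p, hp, rfl⟩ := List.mem_map.1 (List.mem_of_getLast? hk)
      exact h0 p hp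
    · intro q hq
      rcases List.mem_append.1 hq with hq | hq
      · exact h.mem q hq
      · rw [List.mem_singleton] at hq
        subst hq
        exact sub_mem hz (sub_mono (Set.empty_subset _) (condExp_mem z))
    · intro q hq
      rcases List.mem_append.1 hq with hq | hq
      · exact h.condExp_eq_zero q hq
      · rw [List.mem_singleton] at hq
        subst hq
        exact condExp_sub_condExp z
  have h1 := hcons l h fun p hp => h0 p (List.mem_of_head? hp)
  have h2 := hcons _ hconcat fun p hp => by
    rw [List.head?_append_of_ne_nil _ hl] at hp
    exact h0 p (List.mem_of_head? hp)
  have e1 := state_mul_prod_mul_eq_zero hfree hK hl h (condExp_mem y) (condExp_mem z)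
  have e2 := state_mul_prod_mul_eq_zero hfree hK (by simp) hconcat (condExp_mem y) (one_mem _)
  have e3 := state_mul_prod_mul_eq_zero hfree hK (by simp) h1 (one_mem _) (condExp_mem z)
  have e4 := state_mul_prod_mul_eq_zero hfree hK (by simp) h2 (one_mem _) (one_mem _)
  simp only [List.map_append, List.map_cons, List.map_nil, List.prod_append, List.prod_cons,
    List.prod_nil, mul_one, one_mul] at e2 e3 e4
  have : y * (l.map Prod.snd).prod * z =
      condExp S y * (l.map Prod.snd).prod * condExp S z +
      condExp S y * ((l.map Prod.snd).prod * (z - condExp S z)) +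
      (y - condExp S y) * (l.map Prod.snd).prod * condExp S z +
      (y - condExp S y) * ((l.map Prod.snd).prod * (z - condExp S z)) := by
    noncomm_ring
  rw [this, map_add, map_add, map_add, e1, e2, e3, e4]
  simp

/-- Freeness with amalgamation in the envelope: the expectations of `E (X₁ ⋯ Xₙ)` between elements
of the exchangeability system are those of a copy of `X₁ ⋯ Xₙ` with other real indices. -/
theorem condExp_prod_eq_zero (hfree : S.WeakFreeness) (n : ℕ) (i : Fin (n + 1) → ℕ)
    (hi : ∀ j : Fin n, i j.castSucc ≠ i j.succ) (X : Fin (n + 1) → S.Envelope)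
    (hX : ∀ j, X j ∈ sub S {i j}) (hE : ∀ j, condExp S (X j) = 0) :
    condExp S (List.ofFn X).prod = 0 := by
  apply eq_zero_of_state
  intro u v
  rw [state_mul_condExp_mul, map_list_prod, List.map_ofFn]
  -- the real indices of the outer factors become even, those of `X j` become `2 (i j) + 1`
  let K : ℕ → Set ℕ := fun k => if k = 0 then {m | m % 2 = 0} else {2 * (k - 1) + 1}
  have hK : Pairwise fun k l => Disjoint (K k) (K l) := by
    intro k l hkl
    rw [Set.disjoint_left]
    intro m hm hm'
    simp only [K] at hm hm'
    split_ifs at hm hm' with h1 h2 h2 <;>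
    simp only [Set.mem_ofPred_eq, Set.mem_singleton_iff] at hm hm' <;> omega
  have := state_mul_prod_mul_eq_zero' hfree hK (l := List.ofFn fun j =>
    (i j + 1, shift S toDummy (X j))) (by simp) ⟨?_, ?_, ?_⟩ ?_
    (shift_mem (σ := doubling) (fun k _ => ?_) (mem_sub_univ (ofReal S u)))
    (shift_mem (σ := doubling) (fun k _ => ?_) (mem_sub_univ (ofReal S v)))
  · rw [List.map_ofFn] at this
    exact this
  · rw [List.map_ofFn, List.isChain_ofFn]
    intro j hj
    have := hi ⟨j, by omega⟩
    simpa using this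
  · intro p hp
    obtain ⟨j, rfl⟩ := List.mem_ofFn.1 hp
    refine shift_mem (K := {i j}) (fun k hk => ?_) (hX j)
    rw [Set.mem_singleton_iff] at hk
    subst hk
    simp [K, toDummy_apply]
  · intro p hp
    obtain ⟨j, rfl⟩ := List.mem_ofFn.1 hp
    change condExp S (shift S toDummy (X j)) = 0
    rw [condExp_shift, hE]
  · intro p hp
    obtain ⟨j, rfl⟩ := List.mem_ofFn.1 hp
    exact Nat.succ_ne_zero _
  all_goals simp [K, doubling_apply]

end Envelope
end ExchangeabilitySystem

namespace ExchangeabilitySystem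

variable {A U : Type*}
  [Ring A] [StarRing A] [Algebra ℂ A] [StarModule ℂ A]
  [Ring U] [StarRing U] [Algebra ℂ U] [StarModule ℂ U]
  {φ : A →ₗ[ℂ] ℂ} {Φ : U →ₗ[ℂ] ℂ} (S : ExchangeabilitySystem φ Φ)

variable [hS : S.IsReduced]

namespace Envelope

/-! ### The amalgamated free product -/

/-- The subalgebra generated by the algebras of polynomials with a single real index. -/
def freeProduct : StarSubalgebra ℂ S.Envelope :=
  StarAlgebra.adjoin ℂ (⋃ k, (sub S {k} : Set S.Envelope))

variable {S}

theorem sub_singleton_le (k : ℕ) : sub S {k} ≤ freeProduct S := fun _ hx =>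
  StarAlgebra.subset_adjoin ℂ _ (Set.mem_iUnion.2 ⟨k, hx⟩)

theorem sub_empty_le : sub S ∅ ≤ freeProduct S :=
  (sub_mono (Set.empty_subset {0})).trans (sub_singleton_le 0)

theorem ofReal_mem (x : U) : ofReal S x ∈ freeProduct S := by
  suffices S.generated ≤ (freeProduct S).comap (ofReal S) from
    this (hS.generated_eq_top ▸ StarSubalgebra.mem_top)
  refine StarAlgebra.adjoin_le (Set.iUnion_subset fun k => ?_)
  rintro _ ⟨a, rfl⟩
  change ofReal S (S.ι k a) ∈ freeProduct S
  rw [ofReal_ι]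
  refine sub_singleton_le k (mk_mem_sub (S.ι_mem_alg ?_ a))
  intro _
  simp

/-- The injection of `ℕ` that exchanges `0` and `k`. -/
def swapZero (k : ℕ) : ℕ ↪ ℕ := (Equiv.swap 0 k).toEmbedding

theorem swapZero_zero (k : ℕ) : swapZero k 0 = k := Equiv.swap_apply_left 0 k

theorem shift_swapZero_swapZero (k : ℕ) (a : S.Envelope) :
    shift S (swapZero k) (shift S (swapZero k) a) = a := by
  rw [shift_shift]
  have : (swapZero k).trans (swapZero k) = .refl ℕ := by
    ext n
    simp [swapZero]
  rw [this]
  obtain ⟨x, rfl⟩ := mk_surjective S a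
  rw [shift_mk, S.relabel_eq_self (fun n _ => ?_) (S.mem_alg_univ x)]
  rw [liftReal_apply, Function.Embedding.refl_apply]
  split_ifs <;> omega

theorem shift_swapZero_mem (k : ℕ) {a : S.Envelope} (ha : a ∈ sub S {0}) :
    shift S (swapZero k) a ∈ sub S {k} := by
  refine shift_mem (fun n hn => ?_) ha
  rw [Set.mem_singleton_iff] at hn ⊢
  rw [hn, swapZero_zero]

variable (S)

/-- The copies in the free product of the algebra of polynomials with the single real index `0`. -/
def copy (k : ℕ) : sub S {0} →⋆ₐ[ℂ] freeProduct S :=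
  ((shift S (swapZero k)).comp (sub S {0}).subtype).codRestrict _ fun a =>
    sub_singleton_le k (shift_swapZero_mem k a.2)

variable {S}

theorem adjoin_range_copy : StarAlgebra.adjoin ℂ (⋃ k, Set.range (copy S k)) = ⊤ := by
  rw [StarSubalgebra.eq_top_iff]
  rintro ⟨x, hx⟩
  suffices h : freeProduct S ≤
      (StarAlgebra.adjoin ℂ (⋃ k, Set.range (copy S k))).map (freeProduct S).subtype by
    obtain ⟨y, hy, hxy⟩ := h hx
    obtain rfl : y = ⟨x, hx⟩ := Subtype.ext hxy
    exact hy
  refine StarAlgebra.adjoin_le (Set.iUnion_subset fun k a ha => ?_)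
  have h0 : shift S (swapZero k) a ∈ sub S {0} := by
    refine shift_mem (fun n hn => ?_) ha
    rw [Set.mem_singleton_iff] at hn ⊢
    rw [hn]
    exact Equiv.swap_apply_right 0 k
  exact ⟨copy S k ⟨_, h0⟩, StarAlgebra.subset_adjoin ℂ _ (Set.mem_iUnion.2 ⟨k, _, rfl⟩),
    shift_swapZero_swapZero k a⟩

theorem coe_list_prod_ofFn {V : StarSubalgebra ℂ S.Envelope} {n : ℕ} (g : Fin n → V) :
    (((List.ofFn g).prod : V) : S.Envelope) = (List.ofFn fun j => (g j : S.Envelope)).prod := by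
  rw [← StarSubalgebra.subtype_apply, map_list_prod, List.map_ofFn]
  rfl

variable (S) in
/-- The amalgamated free product in the envelope. -/
def amalgamatedFreeProduct (hfree : S.WeakFreeness) :
    AmalgamatedFreeProduct (sub S {0}) (freeProduct S) where
  B := (sub S ∅).comap (freeProduct S).subtype
  E := ((condExp S).comp (freeProduct S).subtype.toAlgHom.toLinearMap).codRestrict
    (Subalgebra.toSubmodule (freeProduct S).toSubalgebra) fun a => sub_empty_le (condExp_mem _)
  E_mem x := condExp_mem (S := S) x
  E_of_mem b hb := Subtype.ext (condExp_of_mem hb)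
  E_bimodule b hb c hc x := Subtype.ext (condExp_mul_mul hb hc _)
  τ := (state S).comp (freeProduct S).subtype.toAlgHom.toLinearMap
  isState := ⟨(isState_state S).map_one, fun x => (isState_state S).nonneg x⟩
  τ_E x := state_condExp (S := S) x
  τ_nondegenerate x hx := Subtype.ext <| eq_zero_of_state fun u v =>
    hx ⟨_, ofReal_mem u⟩ ⟨_, ofReal_mem v⟩
  E_positive x y := condExp_positive (S := S) x y
  κ := copy S
  κ_injective k a b h := by
    have h' : shift S (swapZero k) a = shift S (swapZero k) b := congrArg Subtype.val h
    rw [Subtype.ext_iff, ← shift_swapZero_swapZero k (a : S.Envelope), h',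
      shift_swapZero_swapZero]
  β := ((freeProduct S).subtype.comp (StarSubalgebra.subtype _)).codRestrict _ fun b =>
    sub_mono (Set.empty_subset _) b.2
  κ_β k b := Subtype.ext (shift_of_mem _ b.2)
  E_κ k l a := Subtype.ext <|
    (condExp_shift (swapZero k) (a : S.Envelope)).trans (condExp_shift (swapZero l) _).symm
  generates := adjoin_range_copy
  free n i X hi hX := by
    apply Subtype.ext
    change condExp S ((_ : freeProduct S) : S.Envelope) = 0
    rw [coe_list_prod_ofFn]
    exact condExp_prod_eq_zero hfree n i hi _ (fun j => shift_swapZero_mem _ (X j).2)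
      fun j => congrArg Subtype.val (hX j)

variable (S) in
/-- The embedding of the exchangeability system into the free product. -/
def embedding : U →⋆ₐ[ℂ] freeProduct S := (ofReal S).codRestrict _ ofReal_mem

variable (S) in
/-- The embedding of `A` into the algebra of polynomials with the single real index `0`. -/
def baseEmbedding : A →⋆ₐ[ℂ] sub S {0} :=
  ((ofReal S).comp (S.ι 0)).codRestrict _ fun a => by
    change ofReal S (S.ι 0 a) ∈ sub S {0}
    rw [ofReal_ι]
    exact mk_mem_sub (S.ι_mem_alg (fun _ => by simp) a)

theorem embedding_ι (k : ℕ) (a : A) : embedding S (S.ι k a) = copy S k (baseEmbedding S a) := by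
  apply Subtype.ext
  change ofReal S (S.ι k a) = shift S (swapZero k) (ofReal S (S.ι 0 a))
  rw [ofReal_ι, ofReal_ι, shift_mk, relabel_ι, liftReal_apply, if_pos (by simp)]
  simp [swapZero_zero]

end Envelope
end ExchangeabilitySystem

/-! ### Functions spanned by noncrossing partitions -/

/-- Noncrossing equivalence relations on `ℕ`. -/
def Setoid.IsNoncrossing (r : Setoid ℕ) : Prop :=
  ∀ i j k l, i < j → j < k → k < l → r i k → r j l → r i j

open Classical in
/-- The indicator function of the labellings that are constant on the classes of `r`. -/
def Setoid.indicator (r : Setoid ℕ) (h : ℕ → ℕ) : ℂ := if ∀ i j, r i j → h i = h j then 1 else 0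

theorem Setoid.indicator_eq {r : Setoid ℕ} {h : ℕ → ℕ} {P : Prop} [Decidable P]
    (hP : (∀ i j, r i j → h i = h j) ↔ P) : r.indicator h = if P then 1 else 0 :=
  by classical exact if_congr hP rfl rfl

/-- The functions of a labelling that are spanned by the indicator functions of noncrossing
equivalence relations. -/
def noncrossingSpan : Submodule ℂ ((ℕ → ℕ) → ℂ) :=
  Submodule.span ℂ {g | ∃ r : Setoid ℕ, r.IsNoncrossing ∧ g = r.indicator}

theorem indicator_mem_noncrossingSpan {r : Setoid ℕ} (hr : r.IsNoncrossing) :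
    r.indicator ∈ noncrossingSpan := Submodule.subset_span ⟨r, hr, rfl⟩

theorem const_mem_noncrossingSpan (c : ℂ) : (fun _ => c) ∈ noncrossingSpan := by
  have h : (⊥ : Setoid ℕ).IsNoncrossing := fun i j k l hij hjk _ hik _ => by
    have : i = k := hik
    omega
  have := noncrossingSpan.smul_mem c (indicator_mem_noncrossingSpan h)
  convert this using 1
  funext g
  have h0 : (∀ i j, (⊥ : Setoid ℕ) i j → g i = g j) ↔ True :=
    iff_true_intro fun i j hij => congrArg g hij
  simp [Setoid.indicator_eq h0]

/-- The indicator function of the labellings that agree at the places `j` and `j + 1`. -/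
def adjacentEq (j : ℕ) (h : ℕ → ℕ) : ℂ := if h j = h (j + 1) then 1 else 0

/-- The equivalence relation obtained from `r` by merging the classes of `m` and `m + 1`. -/
def Setoid.merge (r : Setoid ℕ) (m : ℕ) : Setoid ℕ where
  r x y := r x y ∨ (r x m ∨ r x (m + 1)) ∧ (r y m ∨ r y (m + 1))
  iseqv := by
    refine ⟨fun x => Or.inl (r.refl' x), ?_, ?_⟩
    · rintro x y (h | ⟨h, h'⟩)
      · exact Or.inl (r.symm' h)
      · exact Or.inr ⟨h', h⟩
    · rintro x y z (h | ⟨h, h'⟩) (k | ⟨k, k'⟩)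
      · exact Or.inl (r.trans' h k)
      · exact Or.inr ⟨k.imp (r.trans' h) (r.trans' h), k'⟩
      · exact Or.inr ⟨h, h'.imp (r.trans' (r.symm' k)) (r.trans' (r.symm' k))⟩
      · exact Or.inr ⟨h, k'⟩

/-- Merging the classes of two neighbours creates no crossing. -/
theorem Setoid.IsNoncrossing.merge {r : Setoid ℕ} (hr : r.IsNoncrossing) (m : ℕ) :
    (r.merge m).IsNoncrossing := by
  have ht : ∀ {x y z}, r x y → r y z → r x z := r.trans'
  have hs : ∀ {x y}, r x y → r y x := r.symm'
  have hiff : ∀ x, (r x m ∨ r x (m + 1)) ↔ ∃ a, (a = m ∨ a = m + 1) ∧ r x a := by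
    intro x
    constructor
    · rintro (h | h)
      exacts [⟨m, Or.inl rfl, h⟩, ⟨m + 1, Or.inr rfl, h⟩]
    · rintro ⟨a, rfl | rfl, h⟩
      exacts [Or.inl h, Or.inr h]
  have hself : ∀ x, x = m ∨ x = m + 1 → (r x m ∨ r x (m + 1)) := fun x hx =>
    (hiff x).2 ⟨x, hx, r.refl' x⟩
  rintro i j k l hij hjk hkl (hik | ⟨hi, hk⟩) (hjl | ⟨hj, hl⟩)
  · exact Or.inl (hr i j k l hij hjk hkl hik hjl)
  · refine Or.inr ⟨?_, hj⟩
    obtain ⟨a, ha, hja⟩ := (hiff j).1 hj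
    obtain ⟨b, hb, hlb⟩ := (hiff l).1 hl
    by_cases hi : i = m ∨ i = m + 1
    · exact hself i hi
    by_cases hk : k = m ∨ k = m + 1
    · exact (hself k hk).imp (ht hik) (ht hik)
    rcases lt_or_ge m i with h1 | h1
    · exact (hiff i).2 ⟨a, ha, hs (hr a i j k (by omega) hij hjk (hs hja) hik)⟩
    rcases lt_or_ge m k with h2 | h2
    · exact (hiff i).2 ⟨b, hb, hr i b k l (by omega) (by omega) hkl hik (hs hlb)⟩
    · exact (hiff i).2 ⟨a, ha, ht (hr i j k a hij hjk (by omega) hik hja) hja⟩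
  · refine Or.inr ⟨hi, ?_⟩
    obtain ⟨a, ha, hia⟩ := (hiff i).1 hi
    obtain ⟨b, hb, hkb⟩ := (hiff k).1 hk
    by_cases hj : j = m ∨ j = m + 1
    · exact hself j hj
    by_cases hl : l = m ∨ l = m + 1
    · exact (hself l hl).imp (ht hjl) (ht hjl)
    rcases lt_or_ge m j with h1 | h1
    · exact (hiff j).2 ⟨b, hb, hs (hr b j k l (by omega) hjk hkl (hs hkb) hjl)⟩
    rcases lt_or_ge m l with h2 | h2
    · exact (hiff j).2 ⟨a, ha, ht (hs (hr i j a l hij (by omega) (by omega) hia hjl)) hia⟩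
    · exact (hiff j).2 ⟨b, hb, ht (hr j k l b hjk hkl (by omega) hjl hkb) hkb⟩
  · exact Or.inr ⟨hi, hj⟩

theorem adjacentEq_mul_mem {g : (ℕ → ℕ) → ℂ} (hg : g ∈ noncrossingSpan) (m : ℕ) :
    (fun h => adjacentEq m h * g h) ∈ noncrossingSpan := by
  induction hg using Submodule.span_induction with
  | zero =>
    convert noncrossingSpan.zero_mem using 1
    funext h
    simp
  | add f g _ _ hf hg =>
    convert noncrossingSpan.add_mem hf hg using 1
    funext h
    simp [mul_add]
  | smul c f _ hf =>
    convert noncrossingSpan.smul_mem c hf using 1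
    funext h
    simp [mul_left_comm]
  | mem g hg =>
    obtain ⟨r, hr, rfl⟩ := hg
    convert indicator_mem_noncrossingSpan (hr.merge m) using 1
    funext h
    have : (∀ i j, r.merge m i j → h i = h j) ↔
        h m = h (m + 1) ∧ ∀ i j, r i j → h i = h j := by
      constructor
      · intro H
        exact ⟨H _ _ (Or.inr ⟨Or.inl (r.refl' _), Or.inr (r.refl' _)⟩),
          fun i j hij => H i j (Or.inl hij)⟩
      · have hm : h m = h (m + 1) → (∀ i j, r i j → h i = h j) →
            ∀ x, (r x m ∨ r x (m + 1)) → h x = h m := by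
          rintro h1 h2 x (hx | hx)
          exacts [h2 _ _ hx, (h2 _ _ hx).trans h1.symm]
        rintro ⟨h1, h2⟩ i j (hij | ⟨hi, hj⟩)
        · exact h2 i j hij
        · rw [hm h1 h2 i hi, hm h1 h2 j hj]
    classical
    rw [Setoid.indicator_eq this, adjacentEq, Setoid.indicator, ite_and]
    split_ifs <;> simp

/-- The increasing injection of `ℕ` that omits `m`. -/
def skip (m i : ℕ) : ℕ := if i < m then i else i + 1

/-- Gluing the places `m` and `m + 1`: noncrossing relations pull back along the monotone map that
identifies the two places. -/
theorem adjacentEq_mul_comp_skip_mem {g : (ℕ → ℕ) → ℂ} (hg : g ∈ noncrossingSpan) (m : ℕ) :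
    (fun h => adjacentEq m h * g (h ∘ skip m)) ∈ noncrossingSpan := by
  induction hg using Submodule.span_induction with
  | zero =>
    convert noncrossingSpan.zero_mem using 1
    funext h
    simp
  | add f g _ _ hf hg =>
    convert noncrossingSpan.add_mem hf hg using 1
    funext h
    simp [mul_add]
  | smul c f _ hf =>
    convert noncrossingSpan.smul_mem c hf using 1
    funext h
    simp [mul_left_comm]
  | mem g hg =>
    obtain ⟨r, hr, rfl⟩ := hg
    let p : ℕ → ℕ := fun i => if i ≤ m then i else i - 1
    have hp : Monotone p := by
      intro i j hij
      simp only [p]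
      grind
    have hnc : (r.comap p).IsNoncrossing := by
      intro i j k l hij hjk hkl hik hjl
      change r (p i) (p k) at hik
      change r (p j) (p l) at hjl
      change r (p i) (p j)
      rcases (hp hij.le).eq_or_lt with h1 | h1
      · rw [h1]
      rcases (hp hjk.le).eq_or_lt with h2 | h2
      · rwa [h2]
      rcases (hp hkl.le).eq_or_lt with h3 | h3
      · rw [h3] at hik
        exact r.trans' hik (r.symm' hjl)
      · exact hr _ _ _ _ h1 h2 h3 hik hjl
    convert indicator_mem_noncrossingSpan hnc using 1
    funext h
    have hpq : ∀ i, p (skip m i) = i := by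
      intro i
      simp only [p, skip]
      grind
    have hqp : h m = h (m + 1) → ∀ i, h (skip m (p i)) = h i := by
      intro hm i
      by_cases hi : i = m
      · subst hi
        have : skip i (p i) = i + 1 := by simp [p, skip]
        rw [this, hm]
      · congr 1
        simp only [p, skip]
        grind
    have : (∀ i j, r.comap p i j → h i = h j) ↔
        h m = h (m + 1) ∧ ∀ i j, r i j → (h ∘ skip m) i = (h ∘ skip m) j := by
      constructor
      · intro H
        refine ⟨H _ _ ?_, fun i j hij => H _ _ ?_⟩
        · change r (p m) (p (m + 1))
          have : p m = p (m + 1) := by simp [p]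
          rw [this]
        · change r (p _) (p _)
          rwa [hpq, hpq]
      · rintro ⟨h1, h2⟩ i j hij
        rw [← hqp h1 i, ← hqp h1 j]
        exact h2 _ _ hij
    classical
    rw [Setoid.indicator_eq this, adjacentEq, Setoid.indicator, ite_and]
    split_ifs <;> simp

/-- Inserting a singleton at the place `m`. -/
theorem comp_skip_mem {g : (ℕ → ℕ) → ℂ} (hg : g ∈ noncrossingSpan) (m : ℕ) :
    (fun h => g (h ∘ skip m)) ∈ noncrossingSpan := by
  induction hg using Submodule.span_induction with
  | zero => exact noncrossingSpan.zero_mem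
  | add f g _ _ hf hg => exact noncrossingSpan.add_mem hf hg
  | smul c f _ hf => exact noncrossingSpan.smul_mem c hf
  | mem g hg =>
    obtain ⟨r, hr, rfl⟩ := hg
    have hmono : StrictMono (skip m) := by
      intro i j hij
      simp only [skip]
      grind
    let r' : Setoid ℕ :=
      { r := fun x y => x = y ∨ ∃ i j, skip m i = x ∧ skip m j = y ∧ r i j
        iseqv := by
          refine ⟨fun x => Or.inl rfl, ?_, ?_⟩
          · rintro x y (h | ⟨i, j, hi, hj, h⟩)
            · exact Or.inl h.symm
            · exact Or.inr ⟨j, i, hj, hi, r.symm' h⟩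
          · rintro x y z (rfl | ⟨i, j, rfl, rfl, h⟩) (rfl | ⟨i', j', hi', rfl, h'⟩)
            · exact Or.inl rfl
            · exact Or.inr ⟨i', j', hi', rfl, h'⟩
            · exact Or.inr ⟨i, j, rfl, rfl, h⟩
            · rw [hmono.injective hi'] at h'
              exact Or.inr ⟨i, j', rfl, rfl, r.trans' h h'⟩ }
    have hr' : r'.IsNoncrossing := by
      rintro i j k l hij hjk hkl (rfl | ⟨i, k, rfl, rfl, hik⟩) (rfl | ⟨j, l, rfl, rfl, hjl⟩)
      · omega
      · omega
      · omega
      · rw [hmono.lt_iff_lt] at hij hjk hkl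
        exact Or.inr ⟨i, j, rfl, rfl, hr i j k l hij hjk hkl hik hjl⟩
    convert indicator_mem_noncrossingSpan hr' using 1
    funext h
    have : (∀ i j, r' i j → h i = h j) ↔
        ∀ i j, r i j → (h ∘ skip m) i = (h ∘ skip m) j := by
      constructor
      · exact fun H i j hij => H _ _ (Or.inr ⟨i, j, rfl, rfl, hij⟩)
      · rintro H i j (rfl | ⟨i, j, rfl, rfl, hij⟩)
        · rfl
        · exact H i j hij
    classical
    rw [Setoid.indicator_eq this, Setoid.indicator]

namespace AmalgamatedFreeProduct

variable {A U : Type*}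
  [Ring A] [StarRing A] [Algebra ℂ A] [StarModule ℂ A]
  [Ring U] [StarRing U] [Algebra ℂ U] [StarModule ℂ U]
  (F : AmalgamatedFreeProduct A U)

/-! ### Expectations in an amalgamated free product -/

/-- The product of the elements of the list `Y`, the `j`-th of them in the copy with label `h j`. -/
def labelledProd (h : ℕ → ℕ) : List A → U
  | [] => 1
  | y :: Y => F.κ (h 0) y * labelledProd (fun i => h (i + 1)) Y

theorem labelledProd_append (h : ℕ → ℕ) (Y Z : List A) :
    F.labelledProd h (Y ++ Z) =
      F.labelledProd h Y * F.labelledProd (fun i => h (Y.length + i)) Z := by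
  induction Y generalizing h with
  | nil => simp [labelledProd]
  | cons y Y ih =>
    rw [List.cons_append, labelledProd, labelledProd, ih, mul_assoc]
    congr 3
    funext i
    congr 1
    simp
    omega

theorem labelledProd_congr {h h' : ℕ → ℕ} {Y : List A} (H : ∀ i < Y.length, h i = h' i) :
    F.labelledProd h Y = F.labelledProd h' Y := by
  induction Y generalizing h h' with
  | nil => rfl
  | cons y Y ih =>
    rw [labelledProd, labelledProd, H 0 (by simp), ih fun i hi => H (i + 1) (by simpa using hi)]

theorem labelledProd_ofFn (h : ℕ → ℕ) (n : ℕ) (Y : Fin n → A) :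
    F.labelledProd h (List.ofFn Y) = (List.ofFn fun j => F.κ (h j) (Y j)).prod := by
  induction n generalizing h with
  | zero => simp [labelledProd]
  | succ n ih =>
    rw [List.ofFn_succ, labelledProd, ih, List.ofFn_succ, List.prod_cons]
    rfl

theorem E_mul_right {c : U} (hc : c ∈ F.B) (x : U) : F.E (x * c) = F.E x * c := by
  simpa using F.E_bimodule 1 (one_mem _) c hc x

/-- An element of the amalgamated algebra can be moved to the factor on its right. -/
theorem labelledProd_mul_of_mem (b : F.B) (Y Z : List A) (c : F.B) :
    ∃ (Z' : List A) (c' : F.B), Z'.length = Z.length ∧ ∀ h : ℕ → ℕ,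
      F.labelledProd h (Y ++ F.β b :: Z) * c =
        F.labelledProd (h ∘ skip Y.length) (Y ++ Z') * c' := by
  have hY : ∀ h : ℕ → ℕ, F.labelledProd (h ∘ skip Y.length) Y = F.labelledProd h Y := fun h =>
    F.labelledProd_congr fun i hi => congrArg h (if_pos hi)
  have hskip : ∀ i, skip Y.length (Y.length + i) = Y.length + (i + 1) := fun i => by
    rw [skip, if_neg (by omega)]
    omega
  cases Z with
  | nil =>
    refine ⟨[], b * c, rfl, fun h => ?_⟩
    rw [List.append_nil, hY, labelledProd_append, labelledProd, labelledProd, mul_one, F.κ_β,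
      mul_assoc]
    rfl
  | cons z Z =>
    refine ⟨F.β b * z :: Z, c, rfl, fun h => ?_⟩
    simp only [labelledProd_append, hY, labelledProd, Function.comp_apply, hskip, map_mul, F.κ_β,
      mul_assoc]

/-- Neighbouring factors with equal labels can be multiplied. -/
theorem labelledProd_merge {h : ℕ → ℕ} (Y Z : List A) (a b : A)
    (H : h Y.length = h (Y.length + 1)) :
    F.labelledProd h (Y ++ a :: b :: Z) =
      F.labelledProd (h ∘ skip Y.length) (Y ++ (a * b) :: Z) := by
  have hY : F.labelledProd (h ∘ skip Y.length) Y = F.labelledProd h Y :=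
    F.labelledProd_congr fun i hi => congrArg h (if_pos hi)
  have hskip : ∀ i, skip Y.length (Y.length + i) = Y.length + (i + 1) := fun i => by
    rw [skip, if_neg (by omega)]
    omega
  have hskip0 : skip Y.length Y.length = Y.length + 1 := if_neg (lt_irrefl _)
  simp only [labelledProd_append, hY, labelledProd, Function.comp_apply, hskip, hskip0, map_mul,
    mul_assoc, add_zero, zero_add, H]

/-- If all factors are centred and the function of the labelling becomes spanned by noncrossing
indicators as soon as two neighbouring labels are required to be equal, then it is spanned by
noncrossing indicators, since by freeness it vanishes if all neighbouring labels are different. -/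
theorem centred_mem_noncrossingSpan (Y : List A) (c : F.B) (hY : ∀ y ∈ Y, F.E (F.κ 0 y) = 0)
    (H : ∀ m, m + 1 < Y.length →
      (fun h => adjacentEq m h * F.τ (F.labelledProd h Y * c)) ∈ noncrossingSpan) :
    (fun h => F.τ (F.labelledProd h Y * c)) ∈ noncrossingSpan := by
  obtain ⟨n, Y, rfl⟩ : ∃ n, ∃ g : Fin n → A, Y = List.ofFn g :=
    ⟨Y.length, Y.get, (List.ofFn_get Y).symm⟩
  rcases n with _ | n
  · exact const_mem_noncrossingSpan (F.τ (1 * c))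
  set g : (ℕ → ℕ) → ℂ := fun h => F.τ (F.labelledProd h (List.ofFn Y) * c) with hg
  have hdiff : ∀ m ≤ n, (fun h => g h - (∏ j ∈ Finset.range m, (1 - adjacentEq j h)) * g h) ∈
      noncrossingSpan := by
    intro m
    induction m with
    | zero =>
      intro _
      convert noncrossingSpan.zero_mem using 1
      funext h
      simp
    | succ m ih =>
      intro hm
      have hmul : ∀ k, ∀ g' ∈ noncrossingSpan,
          (fun h => (∏ j ∈ Finset.range k, (1 - adjacentEq j h)) * g' h) ∈ noncrossingSpan := by
        intro k
        induction k with
        | zero =>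
          intro g' hg'
          simpa using hg'
        | succ k ihk =>
          intro g' hg'
          have h1 := ihk g' hg'
          convert noncrossingSpan.sub_mem h1 (adjacentEq_mul_mem h1 k) using 1
          funext h
          rw [Finset.prod_range_succ, Pi.sub_apply]
          ring
      convert noncrossingSpan.add_mem (ih (by omega)) (hmul m _ (H m (by simpa using hm))) using 1
      funext h
      rw [Finset.prod_range_succ, Pi.add_apply]
      ring
  convert hdiff n le_rfl using 1
  funext h
  have hzero : (∏ j ∈ Finset.range n, (1 - adjacentEq j h)) * g h = 0 := by
    by_cases hh : ∃ j < n, h j = h (j + 1)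
    · obtain ⟨j, hj, hjj⟩ := hh
      rw [Finset.prod_eq_zero (Finset.mem_range.2 hj), zero_mul]
      rw [adjacentEq, if_pos hjj, sub_self]
    · push Not at hh
      have := F.free n (fun j => h j) Y (fun j => hh j j.2) fun j => by
        rw [F.E_κ _ 0]
        exact hY _ (List.mem_ofFn.2 ⟨j, rfl⟩)
      rw [hg]
      dsimp only
      rw [labelledProd_ofFn, ← F.τ_E, F.E_mul_right c.2, this]
      simp
  rw [hzero, sub_zero]

/-- The noncrossing moment-cumulant formula: as functions of the labelling, the expectations of
products in an amalgamated free product are linear combinations of indicator functions of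
noncrossing partitions. -/
theorem mem_noncrossingSpan (n : ℕ) : ∀ (Y : List A) (c : F.B), Y.length = n →
    (fun h => F.τ (F.labelledProd h Y * c)) ∈ noncrossingSpan := by
  induction n with
  | zero =>
    intro Y c hY
    rw [List.length_eq_zero_iff.1 hY]
    exact const_mem_noncrossingSpan (F.τ (1 * c))
  | succ n ih =>
    -- the first factors `Y` are already centred
    suffices H : ∀ Z Y : List A, ∀ c : F.B, (∀ y ∈ Y, F.E (F.κ 0 y) = 0) →
        (Y ++ Z).length = n + 1 →
        (fun h => F.τ (F.labelledProd h (Y ++ Z) * c)) ∈ noncrossingSpan by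
      intro Z c hZ
      simpa using H Z [] c (by simp) hZ
    intro Z
    induction Z with
    | nil =>
      intro Y c hY hlen
      rw [List.append_nil] at hlen ⊢
      refine F.centred_mem_noncrossingSpan Y c hY fun m hm => ?_
      obtain ⟨Y₁, a, b, Y₂, rfl, rfl⟩ : ∃ Y₁ a b Y₂, Y = Y₁ ++ a :: b :: Y₂ ∧ Y₁.length = m := by
        refine ⟨Y.take m, Y[m], Y[m + 1], Y.drop (m + 2), ?_, by simp; omega⟩
        simp
      have h1 := adjacentEq_mul_comp_skip_mem (ih (Y₁ ++ (a * b) :: Y₂) c (by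
        simp only [List.length_append, List.length_cons] at hlen ⊢
        omega)) Y₁.length
      convert h1 using 1
      funext h
      by_cases hh : h Y₁.length = h (Y₁.length + 1)
      · rw [F.labelledProd_merge Y₁ Y₂ a b hh]
      · rw [adjacentEq, if_neg hh, zero_mul, zero_mul]
    | cons z Z ihZ =>
      intro Y c hY hlen
      let b : F.B := ⟨F.E (F.κ 0 z), F.E_mem _⟩
      have h1 := ihZ (Y ++ [z - F.β b]) c (by
        intro y hy
        rcases List.mem_append.1 hy with hy | hy
        · exact hY y hy
        · rw [List.mem_singleton.1 hy, map_sub, F.κ_β, map_sub, F.E_of_mem b b.2, sub_self])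
        (by
          simp only [List.length_append, List.length_cons, List.length_nil] at hlen ⊢
          omega)
      obtain ⟨Z', c', hZ', hdel⟩ := F.labelledProd_mul_of_mem b Y Z c
      have h2 := comp_skip_mem (ih (Y ++ Z') c' (by
        simp only [List.length_append, List.length_cons] at hlen ⊢
        omega)) Y.length
      convert noncrossingSpan.add_mem h1 h2 using 1
      funext h
      rw [Pi.add_apply]
      rw [← hdel, ← map_add, ← add_mul]
      congr 2
      simp only [labelledProd_append, labelledProd, List.append_assoc, List.singleton_append,
        map_sub]
      noncomm_ring

end AmalgamatedFreeProduct

/-! ### Cumulants -/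

namespace ExchangeabilitySystem

/-- Möbius inversion: the alternating sum that defines the cumulant of a crossing partition kills
the functions spanned by noncrossing indicators. Labellings of `Fin n` are extended to `ℕ` by fresh
labels. -/
theorem sum_mul_mu_eq_zero {g : (ℕ → ℕ) → ℂ} (hg : g ∈ noncrossingSpan) {n : ℕ}
    {π : SetPartition n} (hπ : ¬ π.IsNoncrossing) (ext : (Fin n → ℕ) → ℕ → ℕ)
    (hext : ∀ h, ∀ j : Fin n, ext h j = h j)
    (hext' : ∀ h i j, n ≤ i → ext h i = ext h j → i = j) :
    ∑ σ ∈ Finset.Icc ⊥ π, g (ext σ.blockNumber) * IncidenceAlgebra.mu ℂ σ π = 0 := by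
  classical
  induction hg using Submodule.span_induction with
  | zero => simp
  | add f g _ _ hf hg => simp only [Pi.add_apply, add_mul, Finset.sum_add_distrib, hf, hg, add_zero]
  | smul c f _ hf =>
    simp only [Pi.smul_apply, smul_eq_mul, mul_assoc, ← Finset.mul_sum, hf, mul_zero]
  | mem g hg =>
    obtain ⟨r, hr, rfl⟩ := hg
    -- labels outside `Fin n` are fresh, so that only the restriction of `r` to `Fin n` matters
    by_cases hout : ∀ i j, n ≤ i → r i j → i = j
    · let ρ : SetPartition n := r.comap Fin.val
      have hρ : ρ ≠ π := by
        rintro rfl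
        exact hπ fun i j k l hij hjk hkl hik hjl => hr _ _ _ _ hij hjk hkl hik hjl
      have hind : ∀ σ : SetPartition n,
          r.indicator (ext σ.blockNumber) = if ρ ≤ σ then 1 else 0 := by
        intro σ
        have hσ := hext σ.blockNumber
        refine Setoid.indicator_eq ⟨fun H i j hij => ?_, fun H i j hij => ?_⟩
        · rw [← SetPartition.blockNumber_eq_iff, ← hσ, ← hσ]
          exact H i j hij
        · by_cases hi : n ≤ i
          · rw [hout i j hi hij]
          by_cases hj : n ≤ j
          · rw [hout j i hj (r.symm' hij)]
          have := (SetPartition.blockNumber_eq_iff σ ⟨i, by omega⟩ ⟨j, by omega⟩).2 (H hij)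
          rwa [← hσ ⟨i, _⟩, ← hσ ⟨j, _⟩] at this
      have : ∑ σ ∈ Finset.Icc ⊥ π, r.indicator (ext σ.blockNumber) * IncidenceAlgebra.mu ℂ σ π =
          ∑ σ ∈ Finset.Icc ρ π, IncidenceAlgebra.mu ℂ σ π := by
        simp only [hind, ite_mul, one_mul, zero_mul, ← Finset.sum_filter]
        refine Finset.sum_congr ?_ fun _ _ => rfl
        ext σ
        simp [and_comm]
      rw [this, IncidenceAlgebra.sum_Icc_mu_left, if_neg hρ]
    · push Not at hout
      obtain ⟨i, j, hi, hij, hne⟩ := hout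
      refine Finset.sum_eq_zero fun σ _ => ?_
      rw [Setoid.indicator_eq (P := False)
        (iff_false_intro fun H => hne (hext' _ i j hi (H i j hij)))]
      simp

universe u v

variable {A : Type u} {U : Type v}
  [Ring A] [StarRing A] [Algebra ℂ A] [StarModule ℂ A]
  [Ring U] [StarRing U] [Algebra ℂ U] [StarModule ℂ U]
  {φ : A →ₗ[ℂ] ℂ} {Φ : U →ₗ[ℂ] ℂ} (S : ExchangeabilitySystem φ Φ)

theorem EmbedsInAmalgamatedFreeProduct.crossingCumulantsVanish
    (hS : S.EmbedsInAmalgamatedFreeProduct) : S.CrossingCumulantsVanish := by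
  obtain ⟨A', U', _, _, _, _, _, _, _, _, F, f, θ, -, hτ, hf⟩ := hS
  intro n π X hπ
  let ext : (Fin n → ℕ) → ℕ → ℕ := fun h j =>
    if hj : j < n then h ⟨j, hj⟩ else (∑ i, h i) + 1 + j
  have hext : ∀ h, ∀ j : Fin n, ext h j = h j := fun h j => dif_pos j.2
  have hext' : ∀ h i j, n ≤ i → ext h i = ext h j → i = j := by
    intro h i j hi hij
    simp only [ext, dif_neg (not_lt.2 hi)] at hij
    split_ifs at hij with hj
    · have := Finset.single_le_sum (f := h) (fun _ _ => Nat.zero_le _) (Finset.mem_univ ⟨j, hj⟩)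
      omega
    · omega
  have hword : ∀ h : Fin n → ℕ, Φ (S.word h X) =
      F.τ (F.labelledProd (ext h) (List.ofFn fun j => θ (X j)) * (1 : F.B)) := by
    intro h
    have : S.word h X = ((List.ofFn fun j => (⟨S.ι (h j) (X j), S.ι_mem_generated _ _⟩ :
        S.generated)).prod : S.generated) := by
      rw [← StarSubalgebra.subtype_apply, map_list_prod, List.map_ofFn]
      rfl
    rw [this, ← hτ, map_list_prod, List.map_ofFn, F.labelledProd_ofFn]
    simp only [OneMemClass.coe_one, mul_one, hext]
    congr 3
    funext j
    exact hf _ _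
  rw [cumulant]
  simp only [partitionedExpectation, hword]
  exact sum_mul_mu_eq_zero (F.mem_noncrossingSpan _ _ 1 rfl) hπ ext hext hext'

end ExchangeabilitySystem

namespace ExchangeabilitySystem

universe u v

variable {A : Type u} {U : Type v}
  [Ring A] [StarRing A] [Algebra ℂ A] [StarModule ℂ A]
  [Ring U] [StarRing U] [Algebra ℂ U] [StarModule ℂ U]
  {φ : A →ₗ[ℂ] ℂ} {Φ : U →ₗ[ℂ] ℂ} (S : ExchangeabilitySystem φ Φ)

/-! ### Restriction to the generated algebra -/

/-- The restriction of `Φ` to the algebra generated by the `A_k`. -/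
def restrictedState : S.generated →ₗ[ℂ] ℂ := Φ.comp S.generated.subtype.toAlgHom.toLinearMap

theorem restrictedState_apply (x : S.generated) : S.restrictedState x = Φ x := rfl

/-- The exchangeability system inside the algebra generated by the `A_k`. -/
def restrict : ExchangeabilitySystem φ S.restrictedState where
  isState_base := S.isState_base
  isState := ⟨S.isState.map_one, fun x => S.isState.nonneg x⟩
  ι k := (S.ι k).codRestrict _ (S.ι_mem_generated k)
  ι_injective k _ _ h := S.ι_injective k (congrArg Subtype.val h)
  map_ι k a := S.map_ι k a
  exchangeable n X h σ := by
    rw [restrictedState_apply, restrictedState_apply, ← StarSubalgebra.subtype_apply,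
      ← StarSubalgebra.subtype_apply, map_list_prod S.generated.subtype,
      map_list_prod S.generated.subtype, List.map_ofFn, List.map_ofFn]
    exact S.exchangeable n X h σ

theorem isReduced_restrict (hfaithful : IsFaithful Φ) : S.restrict.IsReduced where
  faithful x hx := Subtype.ext (hfaithful x hx)
  generated_eq_top := by
    rw [StarSubalgebra.eq_top_iff]
    rintro ⟨x, hx⟩
    suffices h : S.generated ≤ S.restrict.generated.map S.generated.subtype by
      obtain ⟨y, hy, hxy⟩ := h hx
      obtain rfl : y = ⟨x, hx⟩ := Subtype.ext hxy
      exact hy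
    refine StarAlgebra.adjoin_le (Set.iUnion_subset fun k => ?_)
    rintro _ ⟨a, rfl⟩
    exact ⟨S.restrict.ι k a, S.restrict.ι_mem_generated k a, rfl⟩

theorem coe_restrict_eval {I : Set ℕ} (t : I → ℕ) (P : FreeAlgebra ℂ (I × A)) :
    (S.restrict.eval t P : U) = S.eval t P := by
  have : S.generated.subtype.toAlgHom.comp (S.restrict.eval t) = S.eval t := by
    ext p
    simp only [eval, AlgHom.coe_comp, Function.comp_apply, FreeAlgebra.lift_ι_apply]
    rfl
  exact DFunLike.congr_fun this P

theorem WeakFreeness.restrict {S : ExchangeabilitySystem φ Φ} (h : S.WeakFreeness) :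
    S.restrict.WeakFreeness := by
  intro n I i P t₁ t₂ hI hi h₁ h₂ h₁₂ hP
  rw [restrictedState_apply, ← StarSubalgebra.subtype_apply,
    map_list_prod S.generated.subtype, List.map_ofFn]
  have := h n I i P t₁ t₂ hI hi h₁ h₂ h₁₂ fun j => by
    rw [← S.coe_restrict_eval, ← S.coe_restrict_eval]
    exact hP j
  rw [← this]
  congr 3
  funext j
  exact S.coe_restrict_eval _ _

theorem embedsInAmalgamatedFreeProduct (hfaithful : IsFaithful Φ) (hfree : S.WeakFreeness) :
    S.EmbedsInAmalgamatedFreeProduct := by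
  have := S.isReduced_restrict hfaithful
  refine ⟨Envelope.sub S.restrict {0}, Envelope.freeProduct S.restrict, inferInstance,
    inferInstance, inferInstance, inferInstance, inferInstance, inferInstance, inferInstance,
    inferInstance, Envelope.amalgamatedFreeProduct S.restrict hfree.restrict,
    Envelope.embedding S.restrict, Envelope.baseEmbedding S.restrict, ?_, ?_, ?_⟩
  · intro x y h
    exact Envelope.ofReal_injective (S := S.restrict) (congrArg Subtype.val h)
  · intro x
    exact Envelope.state_ofReal (S := S.restrict) x
  · intro k a
    exact Envelope.embedding_ι k a

end ExchangeabilitySystem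
end

theorem mainTheorem3 {A U : Type*}
    [Ring A] [StarRing A] [Algebra ℂ A] [StarModule ℂ A]
    [Ring U] [StarRing U] [Algebra ℂ U] [StarModule ℂ U]
    {φ : A →ₗ[ℂ] ℂ} {Φ : U →ₗ[ℂ] ℂ} (S : ExchangeabilitySystem φ Φ)
    (hfaithful : IsFaithful Φ) (hfree : S.WeakFreeness) (hsingleton : S.WeakSingleton) :
    S.CrossingCumulantsVanish ∧ S.EmbedsInAmalgamatedFreeProduct := by
  have h := S.embedsInAmalgamatedFreeProduct hfaithful hfree
  exact ⟨h.crossingCumulantsVanish, h⟩
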